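/- Let $w=(w(n))_{n\ge 0}$ be a non-decreasing sequence of positive real numbers with $\sum_{n\ge 0} 1/w(n)^2<\infty$. Let $X=(X_n)_{n\ge 0}$ be the vertex reinforced random walk on $\mathbb{Z}$ with weight $w$, i.e. the nearest-neighbour process on $\mathbb{Z}$ with $X_0=0$ and $$\mathbb{P}\{X_{n+1}=X_n\pm 1\mid \mathcal{F}_n\}=\frac{w(Z_n(X_n\pm 1))}{w(Z_n(X_n+1))+w(Z_n(X_n-1))},\qquad n\ge 0,$$ where $\mathcal{F}_n=\sigma(X_0,\dots,X_n)$ and $Z_n(y)=\sum_{k=0}^n 1_{\{X_k=y\}}$. For $x\in\mathbb{Z}$ set $Z_\infty(x)=\lim_{n\to\infty}Z_n(x)\in\{0,1,\dots,\infty\}$ and $$Y^{\pm}_\infty(x)=\lim_{n\to\infty}Y^\pm_n(x)\in[0,\infty],\qquad Y_n^{\pm}(x)=\sum_{k=0}^{n-1}\frac{1_{\{X_k=x \text{ and } X_{k+1}=x\pm 1\}}}{w(Z_k(x\pm 1))}.$$ Then, for every $x\in\mathbb{Z}$, up to events of probability zero, $$\{Y_\infty^+(x)<\infty\}=\{Y_\infty^-(x)<\infty\}=\{Z_\infty(x-1)<\infty\}\cup\{Z_\infty(x+1)<\infty\}.$$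 -/

import Mathlib

open MeasureTheory ProbabilityTheory Filter Topology
open scoped ENNReal

namespace VRRW

variable {Ω : Type*}

/-- Local time `Z_n(y) = ∑_{k=0}^n 1_{X_k = y}` of the process `X` at site `y` and time `n`. -/
def localTime (X : ℕ → Ω → ℤ) (n : ℕ) (y : ℤ) (ω : Ω) : ℕ :=
  ∑ k ∈ Finset.range (n + 1), if X k ω = y then 1 else 0

/-- `Z_∞(y) = lim_n Z_n(y)`, the limit of a non-decreasing sequence of natural numbers,
with values in `{0, 1, 2, …, ∞}`. -/
noncomputable def localTimeInf (X : ℕ → Ω → ℤ) (y : ℤ) (ω : Ω) : ℕ∞ :=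
  ⨆ n, (localTime X n y ω : ℕ∞)

/-- `Y_n^±(x) = ∑_{k<n} 1_{X_k = x, X_{k+1} = x ± 1} / w(Z_k(x ± 1))`; the sign is
`e = 1` for `Y^+` and `e = -1` for `Y^-`. -/
noncomputable def Y (w : ℕ → ℝ) (X : ℕ → Ω → ℤ) (e : ℤ) (n : ℕ) (x : ℤ) (ω : Ω) : ℝ :=
  ∑ k ∈ Finset.range n,
    if X k ω = x ∧ X (k + 1) ω = x + e then 1 / w (localTime X k (x + e) ω) else 0

/-- `Y_∞^±(x) = lim_n Y_n^±(x)`, the limit in `[0, ∞]` of a non-decreasing sequence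
(for positive weights), see `tendsto_Y`. -/
noncomputable def YInf (w : ℕ → ℝ) (X : ℕ → Ω → ℤ) (e : ℤ) (x : ℤ) (ω : Ω) : ℝ≥0∞ :=
  ⨆ n, ENNReal.ofReal (Y w X e n x ω)

/-- The supremum defining `YInf` is the limit of `Y_n` for positive weights. -/
theorem tendsto_Y {w : ℕ → ℝ} (hw : ∀ n, 0 < w n) (X : ℕ → Ω → ℤ) (e x : ℤ) (ω : Ω) :
    Tendsto (fun n => ENNReal.ofReal (Y w X e n x ω)) atTop (𝓝 (YInf w X e x ω)) := by
  refine tendsto_atTop_iSup (monotone_nat_of_le_succ fun n => ENNReal.ofReal_le_ofReal ?_)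
  rw [Y, Y, Finset.sum_range_succ]
  refine le_add_of_nonneg_right ?_
  split_ifs
  · exact one_div_nonneg.2 (hw _).le
  · exact le_rfl

/-- `X` is, under `P`, a vertex reinforced random walk on `ℤ` with weight sequence `w`,
started at `0` from the trivial local time configuration. -/
structure IsVRRW [MeasurableSpace Ω] (P : Measure Ω) (w : ℕ → ℝ) (X : ℕ → Ω → ℤ) : Prop where
  measurable : ∀ n, Measurable (X n)
  start : ∀ᵐ ω ∂P, X 0 ω = 0
  nearest_neighbour : ∀ n, ∀ᵐ ω ∂P, X (n + 1) ω = X n ω + 1 ∨ X (n + 1) ω = X n ω - 1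
  /-- Conditional law of the next jump given the natural filtration: for `e = ± 1`,
  `P(X_{n+1} = X_n + e | ℱ_n) = w(Z_n(X_n + e)) / (w(Z_n(X_n + 1)) + w(Z_n(X_n - 1)))`. -/
  transition : ∀ n, ∀ e : ℤ, e = 1 ∨ e = -1 →
    P⟦{ω | X (n + 1) ω = X n ω + e} |
        Filtration.natural X (fun k => (measurable k).stronglyMeasurable) n⟧
      =ᵐ[P] fun ω => w (localTime X n (X n ω + e) ω) /
        (w (localTime X n (X n ω + 1) ω) + w (localTime X n (X n ω - 1) ω))

end VRRW

/-! Put `A_n = ∑ 1 / (w(Z_k(x+1)) + w(Z_k(x-1)))`, summed over the times `k < n` with `X_k = x`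
(`compensator`). A jump from `x` to `x ± 1` adds `1 / w(Z_k(x ± 1))` to `Y^±` and has conditional
probability proportional to that same weight, so `A` compensates both `Y^+` and `Y^-`. Each such
jump uses up a new index of `w`, so the squared jumps sum to at most `∑ 1/w²` and the two
martingales are bounded in `L²`. They converge almost surely, hence `Y^+_∞ < ∞`, `Y^-_∞ < ∞` and
`A_∞ < ∞` agree almost surely (`IsVRRW.ae_YInf_lt_top_iff`). If `x ± 1` is visited finitely often,
`Y^±` has finitely many nonzero terms.

What remains is that, almost surely, `A_∞ < ∞` excludes infinitely many visits to both neighbours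
(`IsVRRW.ae_notMem_tiePaths`). The walk is realised by a Rubin-type construction: each site carries,
for each direction, a sequence of independent exponential clocks run at the speed of the target's
weight (`state`, `IsVRRW.map_path_eq`). If `A_∞ < ∞`, the total clock time spent at `x` is finite
(`ae_bddAbove_clock`), and in the bad event both directions at `x` ring infinitely often with alarms
accumulating at that same finite time.

Now lengthen only the first rightward clock at `x`. A monotone comparison of the two paths
(`lags_all`) shows that leftward alarms at `x` do not get later, while rightward alarms get later by
a fixed positive amount. The two accumulation points therefore cannot coincide for both values of
this clock (`not_both_tie`). Given all other clocks, at most one value of it is bad, and the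
exponential law has no atoms (`clockLaw_walk_tiePaths`). -/

namespace VRRW

/-! ### Deterministic paths driven by clocks -/

/-- Local time of the deterministic path `p`. -/
def visits (p : ℕ → ℤ) (n : ℕ) (y : ℤ) : ℕ :=
  ∑ k ∈ Finset.range (n + 1), if p k = y then 1 else 0

/-- The path `p` jumps from `y` to `y + e` at time `k`. -/
abbrev IsJump (p : ℕ → ℤ) (e y : ℤ) (k : ℕ) : Prop := p k = y ∧ p (k + 1) = y + e

/-- Number of jumps from `y` to `y + e` made by the path `p` before time `n`. -/
def jumps (p : ℕ → ℤ) (e : ℤ) (n : ℕ) (y : ℤ) : ℕ := Nat.count (IsJump p e y) n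

/-- Local clock time at `y` of the last jump from `y` to `y + e` before time `n`, when the `i`-th
waiting time in direction `e` at `y` is `ρ (y, e, i)` divided by the current weight of `y + e`. -/
noncomputable def alarm (w : ℕ → ℝ) (ρ : ℤ × ℤ × ℕ → ℝ) (p : ℕ → ℤ) (e : ℤ) (n : ℕ) (y : ℤ) : ℝ :=
  ∑ k ∈ Finset.range n,
    if IsJump p e y k then ρ (y, e, jumps p e k y) / w (visits p k (y + e)) else 0

/-- `p` is a nearest neighbour path driven by the clocks `ρ`, and `S n y` is the total clock time
elapsed at `y` before step `n`. -/
structure IsClockPath (w : ℕ → ℝ) (ρ : ℤ × ℤ × ℕ → ℝ) (p : ℕ → ℤ) (S : ℕ → ℤ → ℝ) : Prop where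
  start : p 0 = 0
  step : ∀ n, p (n + 1) = p n + 1 ∨ p (n + 1) = p n - 1
  mono : ∀ y, Monotone fun n => S n y
  strict : ∀ n, S n (p n) < S (n + 1) (p n)
  ring : ∀ n e, e = 1 ∨ e = -1 → p (n + 1) = p n + e →
    alarm w ρ p e (n + 1) (p n) = S (n + 1) (p n)
  wait : ∀ n e, e = 1 ∨ e = -1 →
    S (n + 1) (p n) ≤ alarm w ρ p e n (p n)
      + ρ (p n, e, jumps p e n (p n)) / w (visits p n (p n + e))

theorem visits_succ (p : ℕ → ℤ) (n : ℕ) (y : ℤ) :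
    visits p (n + 1) y = visits p n y + if p (n + 1) = y then 1 else 0 := by
  rw [visits, Finset.sum_range_succ, visits]

theorem jumps_zero (p : ℕ → ℤ) (e y : ℤ) : jumps p e 0 y = 0 := by simp [jumps]

theorem jumps_succ (p : ℕ → ℤ) (e : ℤ) (n : ℕ) (y : ℤ) :
    jumps p e (n + 1) y = jumps p e n y + if IsJump p e y n then 1 else 0 := by
  rw [jumps, Nat.count_succ, jumps]

theorem alarm_succ (w : ℕ → ℝ) (ρ : ℤ × ℤ × ℕ → ℝ) (p : ℕ → ℤ) (e : ℤ) (n : ℕ) (y : ℤ) :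
    alarm w ρ p e (n + 1) y = alarm w ρ p e n y +
      if IsJump p e y n then ρ (y, e, jumps p e n y) / w (visits p n (y + e)) else 0 := by
  rw [alarm, Finset.sum_range_succ, alarm]

/-- Indexing by the rank of the jump instead of its time allows alarms of two different paths to be
compared term by term. -/
theorem alarm_eq_sum (w : ℕ → ℝ) (ρ : ℤ × ℤ × ℕ → ℝ) (p : ℕ → ℤ) (e : ℤ) (n : ℕ) (y : ℤ) :
    alarm w ρ p e n y = ∑ i ∈ Finset.range (jumps p e n y),
      ρ (y, e, i) / w (visits p (Nat.nth (IsJump p e y) i) (y + e)) := by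
  induction n with
  | zero => simp [alarm, jumps]
  | succ n ih =>
    rw [alarm_succ, jumps_succ, ih]
    split_ifs with h
    · rw [Finset.sum_range_succ, jumps, Nat.nth_count h]
    · simp

theorem nth_of_lt_count {q : ℕ → Prop} [DecidablePred q] {i n : ℕ} (h : i < Nat.count q n) :
    q (Nat.nth q i) ∧ Nat.count q (Nat.nth q i) = i := by
  have hc : ∀ hf : (Set.ofPred q).Finite, i < hf.toFinset.card := fun hf =>
    h.trans_le (Nat.count_le_card hf n)
  exact ⟨Nat.nth_mem i hc, Nat.count_nth hc⟩

/-- The edge between `y` and `y + e` is crossed alternately in the two directions, so the counts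
differ only through the sides on which the path starts and currently stands. -/
theorem jumps_conservation {p : ℕ → ℤ} (h0 : p 0 = 0)
    (hstep : ∀ n, p (n + 1) = p n + 1 ∨ p (n + 1) = p n - 1)
    {e : ℤ} (he : e = 1 ∨ e = -1) (n : ℕ) (y : ℤ) :
    jumps p e n y + (if 0 < e * (0 - y) then 1 else 0) =
      jumps p (-e) n (y + e) + if 0 < e * (p n - y) then 1 else 0 := by
  induction n with
  | zero => simp [jumps_zero, h0]
  | succ n ih =>
    rw [jumps_succ, jumps_succ]
    unfold IsJump
    rcases he with rfl | rfl <;> rcases hstep n with h | h <;> rw [h] <;>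
      split_ifs at ih ⊢ <;> omega

theorem visits_eq_jumps {p : ℕ → ℤ}
    (hstep : ∀ n, p (n + 1) = p n + 1 ∨ p (n + 1) = p n - 1)
    {e : ℤ} (he : e = 1 ∨ e = -1) (n : ℕ) (y : ℤ) :
    visits p n y = jumps p e n y + jumps p (-e) n y + if p n = y then 1 else 0 := by
  induction n with
  | zero => simp [jumps_zero, visits, -Finset.sum_boole]
  | succ n ih =>
    rw [jumps_succ, jumps_succ, visits_succ, ih]
    unfold IsJump
    rcases he with rfl | rfl <;> rcases hstep n with h | h <;> rw [h] <;>
      split_ifs <;> omega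

/-! ### Monotone comparison of two clock-driven paths -/

/-- Whenever both paths are on the `e` side of `y` after the same number of jumps from `y` to
`y + e`, the path `p'` has made at least as many jumps from `y` to `y - e` as `p`. -/
def Lags (e : ℤ) (p p' : ℕ → ℤ) (n m : ℕ) : Prop :=
  ∀ y, 0 < e * (p n - y) → 0 < e * (p' m - y) → jumps p e n y = jumps p' e m y →
    jumps p (-e) n y ≤ jumps p' (-e) m y

section Comparison

variable {w : ℕ → ℝ} {ρ ρ' : ℤ × ℤ × ℕ → ℝ} {p p' : ℕ → ℤ} {S S' : ℕ → ℤ → ℝ} {e : ℤ}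

/-- Conservation across the edge gives equally many returns from `y + e` to `y`. The hypothesis on
`Lags`, applied at the site `y + e`, then compares the other exits from `y + e`, and off `y + e` the
visits to it are exactly the exits. -/
theorem visits_le_of_lags (hp : IsClockPath w ρ p S) (hp' : IsClockPath w ρ' p' S')
    (he : e = 1 ∨ e = -1) {n m : ℕ} {y : ℤ} (hn : p n = y) (hm : p' m = y)
    (hJ : jumps p e n y = jumps p' e m y) (h : Lags (-e) p' p m n) :
    visits p' m (y + e) ≤ visits p n (y + e) := by
  have c := jumps_conservation hp.start hp.step he n y
  have c' := jumps_conservation hp'.start hp'.step he m y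
  rw [hn] at c
  rw [hm] at c'
  have hL : jumps p' (-e) m (y + e) = jumps p (-e) n (y + e) := by omega
  have key := h (y + e) (by rw [hm]; rcases he with rfl | rfl <;> ring_nf <;> norm_num)
    (by rw [hn]; rcases he with rfl | rfl <;> ring_nf <;> norm_num) hL
  rw [neg_neg] at key
  rw [visits_eq_jumps hp.step he, visits_eq_jumps hp'.step he,
    if_neg (by rw [hm]; omega), if_neg (by rw [hn]; omega)]
  omega

/-- For jumps of equal rank, the path with the shorter clock also sees the larger local time at `y +
e`, so each of its waiting times is shorter. -/
theorem alarm_le_of_lags (hw : ∀ n, 0 < w n) (hmono : Monotone w)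
    (hp : IsClockPath w ρ p S) (hp' : IsClockPath w ρ' p' S')
    (he : e = 1 ∨ e = -1) {n m : ℕ} {y : ℤ} (hpos : ∀ i, 0 < ρ i)
    (hρ : ∀ i, ρ (y, e, i) ≤ ρ' (y, e, i))
    (hJ : jumps p e n y = jumps p' e m y) (h : ∀ n' < n, ∀ m' < m, Lags (-e) p' p m' n') :
    alarm w ρ p e n y ≤ alarm w ρ' p' e m y := by
  rw [alarm_eq_sum, alarm_eq_sum, ← hJ]
  refine Finset.sum_le_sum fun i hi => ?_
  have hi1 : i < Nat.count (IsJump p e y) n := by simpa [jumps] using hi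
  have hi2 : i < Nat.count (IsJump p' e y) m := by
    have : i < jumps p e n y := by simpa using hi
    rw [hJ] at this
    simpa [jumps] using this
  obtain ⟨a1, c1⟩ := nth_of_lt_count hi1
  obtain ⟨a2, c2⟩ := nth_of_lt_count hi2
  have b1 := Nat.nth_lt_of_lt_count hi1
  have b2 := Nat.nth_lt_of_lt_count hi2
  refine div_le_div₀ ((hpos _).le.trans (hρ i)) (hρ i) (hw _) (hmono ?_)
  exact visits_le_of_lags hp hp' he a1.1 a2.1 (c1.trans c2.symm) (h _ b1 _ b2)

/-- Induction step. A path that was not at `y` one step earlier can be moved back one step; what is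
left is the case where both paths have just made their jump of the same rank from `y` to `y + e`. -/
theorem lags_of_lags_lt (hw : ∀ n, 0 < w n) (hmono : Monotone w)
    (hp : IsClockPath w ρ p S) (hp' : IsClockPath w ρ' p' S')
    (he : e = 1 ∨ e = -1) (hpos : ∀ i, 0 < ρ i) (hpos' : ∀ i, 0 < ρ' i)
    (hρ : ∀ y i, ρ (y, e, i) ≤ ρ' (y, e, i)) (hρ' : ∀ y i, ρ' (y, -e, i) ≤ ρ (y, -e, i))
    {n m : ℕ} (ih : ∀ n' m', n' + m' < n + m → Lags e p p' n' m' ∧ Lags (-e) p' p m' n') :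
    Lags e p p' n m := by
  intro y hn hm hJ
  rcases n with _ | n
  · simp [jumps_zero]
  by_cases hny : p n = y
  swap
  · have e1 : ∀ d, jumps p d (n + 1) y = jumps p d n y := fun d => by
      rw [jumps_succ, if_neg (fun h => hny h.1), add_zero]
    rw [e1] at hJ ⊢
    refine (ih n m (by omega)).1 y ?_ hm hJ
    rcases he with rfl | rfl <;> rcases hp.step n with h | h <;> rw [h] at hn <;> omega
  have hn' : p (n + 1) = y + e := by
    rcases he with rfl | rfl <;> rcases hp.step n with h | h <;> rw [h] at hn ⊢ <;> omega
  have e1 : jumps p e (n + 1) y = jumps p e n y + 1 := by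
    rw [jumps_succ, if_pos ⟨hny, hn'⟩]
  have hne : y + e ≠ y + -e := by omega
  have e2 : jumps p (-e) (n + 1) y = jumps p (-e) n y := by
    rw [jumps_succ, if_neg (fun h => hne (hn'.symm.trans h.2)), add_zero]
  rcases m with _ | m
  · rw [jumps_zero] at hJ; omega
  by_cases hmy : p' m = y
  swap
  · have e1 : ∀ d, jumps p' d (m + 1) y = jumps p' d m y := fun d => by
      rw [jumps_succ, if_neg (fun h => hmy h.1), add_zero]
    rw [e1] at hJ ⊢
    refine (ih (n + 1) m (by omega)).1 y hn ?_ hJ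
    rcases he with rfl | rfl <;> rcases hp'.step m with h | h <;> rw [h] at hm <;> omega
  have hm' : p' (m + 1) = y + e := by
    rcases he with rfl | rfl <;> rcases hp'.step m with h | h <;> rw [h] at hm ⊢ <;> omega
  have e2' : jumps p' (-e) (m + 1) y = jumps p' (-e) m y := by
    rw [jumps_succ, if_neg (fun h => hne (hm'.symm.trans h.2)), add_zero]
  rw [e2, e2']
  -- If `p` had made more jumps in direction `-e`, its jump of rank `l` in that direction would have
  -- rung before the current `e` alarm of `p`. That alarm is no later than the one of `p'`, which
  -- precedes the ring of rank `l` of `p'` in direction `-e`, itself no later than the one of `p`: a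
  -- cycle with a strict inequality.
  by_contra! hlt
  set l := jumps p' (-e) m y with hl
  have he' : -e = 1 ∨ -e = -1 := by omega
  have hlt' : l < Nat.count (IsJump p (-e) y) n := hlt
  set k := Nat.nth (IsJump p (-e) y) l with hk
  have k1 : IsJump p (-e) y k := (nth_of_lt_count hlt').1
  have k2 : k < n := Nat.nth_lt_of_lt_count hlt'
  have k3 : jumps p (-e) k y = l := (nth_of_lt_count hlt').2
  have s1 : alarm w ρ p (-e) (k + 1) y = S (k + 1) y := by
    have := hp.ring k (-e) he' (by rw [k1.1, k1.2]); rwa [k1.1] at this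
  have s2 : S (k + 1) y ≤ S n y := hp.mono y k2
  have s3 : S n y < S (n + 1) y := by have := hp.strict n; rwa [hny] at this
  have s4 : alarm w ρ p e (n + 1) y = S (n + 1) y := by
    have := hp.ring n e he (by rw [hny, hn']); rwa [hny] at this
  have s5 : alarm w ρ p e (n + 1) y ≤ alarm w ρ' p' e (m + 1) y :=
    alarm_le_of_lags hw hmono hp hp' he hpos (hρ y) hJ
      (fun n' h1 m' h2 => (ih n' m' (by omega)).2)
  have s6 : alarm w ρ' p' e (m + 1) y = S' (m + 1) y := by
    have := hp'.ring m e he (by rw [hmy, hm']); rwa [hmy] at this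
  have s7 : S' (m + 1) y ≤ alarm w ρ' p' (-e) m y + ρ' (y, -e, l) / w (visits p' m (y + -e)) := by
    have := hp'.wait m (-e) he'; rwa [hmy] at this
  have s8 : alarm w ρ' p' (-e) m y ≤ alarm w ρ p (-e) k y :=
    alarm_le_of_lags hw hmono hp' hp he' hpos' (hρ' y) k3.symm
      (fun m' h1 n' h2 => by rw [neg_neg]; exact (ih n' m' (by omega)).1)
  have s9 : visits p k (y + -e) ≤ visits p' m (y + -e) :=
    visits_le_of_lags hp' hp he' hmy k1.1 k3.symm
      (by rw [neg_neg]; exact (ih k m (by omega)).1)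
  have s10 : ρ' (y, -e, l) / w (visits p' m (y + -e)) ≤ ρ (y, -e, l) / w (visits p k (y + -e)) :=
    div_le_div₀ (hpos _).le (hρ' y l) (hw _) (hmono s9)
  have s11 := alarm_succ w ρ p (-e) k y
  rw [if_pos k1, k3] at s11
  linarith

/-- The hypotheses are invariant under exchanging `(e, p)` with `(-e, p')`, and each of the two
statements uses the other at earlier times, hence one joint induction on `n + m`. -/
theorem lags_all (hw : ∀ n, 0 < w n) (hmono : Monotone w)
    (hp : IsClockPath w ρ p S) (hp' : IsClockPath w ρ' p' S')
    (he : e = 1 ∨ e = -1) (hpos : ∀ i, 0 < ρ i) (hpos' : ∀ i, 0 < ρ' i)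
    (hρ : ∀ y i, ρ (y, e, i) ≤ ρ' (y, e, i)) (hρ' : ∀ y i, ρ' (y, -e, i) ≤ ρ (y, -e, i))
    (n m : ℕ) : Lags e p p' n m ∧ Lags (-e) p' p m n := by
  induction hN : n + m using Nat.strong_induction_on generalizing n m with
  | _ N ih =>
    subst hN
    refine ⟨lags_of_lags_lt hw hmono hp hp' he hpos hpos' hρ hρ'
      fun n' m' h => ih _ h n' m' rfl, ?_⟩
    refine lags_of_lags_lt hw hmono hp' hp (by omega) hpos' hpos hρ' (by simpa using hρ)
      fun m' n' h => ?_
    rw [neg_neg]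
    exact (ih (n' + m') (by omega) n' m' rfl).symm

theorem exists_jump_ge {x : ℤ} (hp : ∀ n, p (n + 1) = p n + 1 ∨ p (n + 1) = p n - 1)
    (he : e = 1 ∨ e = -1) (h1 : ∀ N, ∃ n ≥ N, p n = x + e) (h2 : ∀ N, ∃ n ≥ N, p n = x - e)
    (N : ℕ) : ∃ n ≥ N, IsJump p e x n := by
  by_contra! hno
  obtain ⟨a, ha, hax⟩ := h2 N
  have stay : ∀ n ≥ a, e * (p n - x) ≤ 0 := by
    intro n hn
    induction n, hn using Nat.le_induction with
    | base => rw [hax]; rcases he with rfl | rfl <;> omega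
    | succ n hn ih =>
      have := hno n (by omega)
      unfold IsJump at this
      rcases he with rfl | rfl <;> rcases hp n with h | h <;> rw [h] at this ⊢ <;> omega
  obtain ⟨b, hb, hbx⟩ := h1 a
  have := stay b hb
  rw [hbx] at this
  rcases he with rfl | rfl <;> omega

/-- Since both directions ring infinitely often, the total clock time at `x` is the limit of the
alarms in either direction. Leftward alarms give `s' ≤ s`; rightward alarms give `s + η ≤ s'` with
`η > 0`. -/
theorem not_both_tie (hw : ∀ n, 0 < w n) (hmono : Monotone w)
    (hp : IsClockPath w ρ p S) (hp' : IsClockPath w ρ' p' S')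
    (hpos : ∀ i, 0 < ρ i) (hpos' : ∀ i, 0 < ρ' i) {x : ℤ}
    (hρ : ∀ i, i ≠ (x, 1, 0) → ρ' i = ρ i) (hlt : ρ (x, 1, 0) < ρ' (x, 1, 0))
    (h1 : ∀ N, ∃ n ≥ N, p n = x + 1) (h2 : ∀ N, ∃ n ≥ N, p n = x - 1)
    (h1' : ∀ N, ∃ n ≥ N, p' n = x + 1) (h2' : ∀ N, ∃ n ≥ N, p' n = x - 1)
    (hS : BddAbove (Set.range fun n => S n x)) (hS' : BddAbove (Set.range fun n => S' n x)) :
    False := by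
  have hle : ∀ i, ρ i ≤ ρ' i := fun i => by
    by_cases hi : i = (x, 1, 0)
    · rw [hi]; exact hlt.le
    · exact (hρ i hi).ge
  have hL := lags_all hw hmono hp hp' (Or.inl rfl) hpos hpos' (fun y i => hle _)
    (fun y i => (hρ _ (by simp)).le)
  have inf : ∀ {q : ℕ → ℤ} {e : ℤ}, (∀ N, ∃ n ≥ N, IsJump q e x n) →
      {n | IsJump q e x n}.Infinite := fun h =>
    Set.infinite_of_forall_exists_gt fun a => by
      obtain ⟨n, hn, hq⟩ := h (a + 1); exact ⟨n, hq, by omega⟩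
  have R := inf (exists_jump_ge hp.step (Or.inl rfl) h1 h2)
  have L := inf (exists_jump_ge hp.step (e := -1) (x := x) (Or.inr rfl) (by simpa [sub_eq_add_neg] using h2)
    (by simpa using h1))
  have R' := inf (exists_jump_ge hp'.step (Or.inl rfl) h1' h2')
  have L' := inf (exists_jump_ge hp'.step (e := -1) (x := x) (Or.inr rfl) (by simpa [sub_eq_add_neg] using h2')
    (by simpa using h1'))
  set s := ⨆ n, S n x with hs
  set s' := ⨆ n, S' n x with hs'
  have ring : ∀ {ρ : ℤ × ℤ × ℕ → ℝ} {p : ℕ → ℤ} {S : ℕ → ℤ → ℝ}, IsClockPath w ρ p S →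
      ∀ {e : ℤ}, e = 1 ∨ e = -1 → ∀ n, IsJump p e x n → alarm w ρ p e (n + 1) x = S (n + 1) x := by
    intro ρ p S hp e he n hn
    have := hp.ring n e he (by rw [hn.1, hn.2])
    rwa [hn.1] at this
  have same : ∀ {ρ : ℤ × ℤ × ℕ → ℝ} {p : ℕ → ℤ} {S : ℕ → ℤ → ℝ}, IsClockPath w ρ p S →
      ∀ {e : ℤ}, e = 1 ∨ e = -1 → {n | IsJump p e x n}.Infinite → ∀ r,
      IsJump p e x (Nat.nth (IsJump p e x) r) ∧
        jumps p e (Nat.nth (IsJump p e x) r) x = r := by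
    intro ρ p S hp e he hinf r
    exact ⟨Nat.nth_mem_of_infinite hinf r, Nat.count_nth_of_infinite hinf r⟩
  have hle1 : s' ≤ s := by
    refine ciSup_le fun n => ?_
    obtain ⟨k, hk, hkJ⟩ := L'.exists_gt n
    rw [Set.mem_ofPred_eq] at hk
    obtain ⟨a, b⟩ := same hp (Or.inr rfl) L (jumps p' (-1) k x)
    set k' := Nat.nth (IsJump p (-1) x) (jumps p' (-1) k x)
    calc S' n x ≤ S' (k + 1) x := hp'.mono x (by omega)
      _ = alarm w ρ' p' (-1) (k + 1) x := (ring hp' (Or.inr rfl) k hk).symm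
      _ ≤ alarm w ρ p (-1) (k' + 1) x :=
          alarm_le_of_lags hw hmono hp' hp (Or.inr rfl) hpos' (fun i => (hρ _ (by simp)).le)
            (by rw [jumps_succ, jumps_succ, if_pos a, if_pos hk, b])
            (fun m' _ n' _ => by rw [neg_neg]; exact (hL n' m').1)
      _ = S (k' + 1) x := ring hp (Or.inr rfl) k' a
      _ ≤ s := le_ciSup hS (k' + 1)
  -- The altered clock is divided by the weight seen at the first rightward jump of `p`, so `η` is
  -- its lengthening in clock time along `p`.
  set B := visits p (Nat.nth (IsJump p 1 x) 0) (x + 1)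
  set η := (ρ' (x, 1, 0) - ρ (x, 1, 0)) / w B with hη
  have hηpos : 0 < η := div_pos (by linarith) (hw _)
  have hle2 : s + η ≤ s' := by
    rw [← le_sub_iff_add_le]
    refine ciSup_le fun n => ?_
    rw [le_sub_iff_add_le]
    obtain ⟨k, hk, hkJ⟩ := R.exists_gt n
    rw [Set.mem_ofPred_eq] at hk
    obtain ⟨a, b⟩ := same hp' (Or.inl rfl) R' (jumps p 1 k x)
    set k' := Nat.nth (IsJump p' 1 x) (jumps p 1 k x)
    have hJ : jumps p 1 (k + 1) x = jumps p' 1 (k' + 1) x := by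
      rw [jumps_succ, jumps_succ, if_pos a, if_pos hk, b]
    calc S n x + η ≤ S (k + 1) x + η := by gcongr; exact hp.mono x (by omega)
      _ = alarm w ρ p 1 (k + 1) x + η := by rw [ring hp (Or.inl rfl) k hk]
      _ = alarm w ρ' p 1 (k + 1) x := by
          -- Only the term of rank `0` involves the altered clock.
          rw [alarm_eq_sum, alarm_eq_sum, jumps_succ, if_pos hk, Finset.sum_range_succ',
            Finset.sum_range_succ', add_assoc]
          congr 1
          · exact Finset.sum_congr rfl fun i _ => by rw [hρ _ (by simp)]
          · rw [hη]; ring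
      _ ≤ alarm w ρ' p' 1 (k' + 1) x := by
          rw [alarm_eq_sum, alarm_eq_sum, ← hJ]
          refine Finset.sum_le_sum fun i hi => ?_
          obtain ⟨a1, b1⟩ := same hp (Or.inl rfl) R i
          obtain ⟨a2, b2⟩ := same hp' (Or.inl rfl) R' i
          refine div_le_div_of_nonneg_left (hpos' _).le (hw _) (hmono ?_)
          exact visits_le_of_lags hp hp' (Or.inl rfl) a1.1 a2.1 (b1.trans b2.symm) (hL _ _).2
      _ = S' (k' + 1) x := ring hp' (Or.inl rfl) k' a
      _ ≤ s' := le_ciSup hS' (k' + 1)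
  linarith

end Comparison

/-! ### Exponential clocks: memorylessness, resampling and residual clocks -/

instance : IsProbabilityMeasure (expMeasure 1) := isProbabilityMeasure_expMeasure one_pos

theorem measurable_exponentialPDF (r : ℝ) : Measurable (exponentialPDF r) :=
  (measurable_exponentialPDFReal r).ennreal_ofReal

theorem lintegral_expMeasure {f : ℝ → ℝ≥0∞} (hf : Measurable f) :
    ∫⁻ s, f s ∂expMeasure 1 = ∫⁻ s, exponentialPDF 1 s * f s := by
  rw [expMeasure, gammaMeasure]
  exact lintegral_withDensity_eq_lintegral_mul _ (measurable_exponentialPDF 1) hf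

theorem expMeasure_Iic_zero : expMeasure 1 (Set.Iic 0) = 0 := by
  have h : MeasurableSet (Set.Iic (0 : ℝ)) := measurableSet_Iic
  rw [expMeasure, gammaMeasure, withDensity_apply _ h, setLIntegral_congr Iio_ae_eq_Iic.symm]
  exact lintegral_exponentialPDF_of_nonpos le_rfl

theorem expMeasure_ae_pos : ∀ᵐ s ∂expMeasure 1, 0 < s := by
  rw [ae_iff]
  convert expMeasure_Iic_zero using 2
  ext s
  simp

instance : NullSingletonClass (expMeasure 1) := by
  rw [expMeasure, gammaMeasure]; infer_instance

theorem lintegral_exp_neg_mul_expMeasure {c : ℝ} (hc : -1 < c) :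
    ∫⁻ s, ENNReal.ofReal (Real.exp (-(c * s))) ∂expMeasure 1 = ENNReal.ofReal (1 / (1 + c)) := by
  have h1 : 0 < 1 + c := by linarith
  rw [lintegral_expMeasure (by fun_prop)]
  have : ∀ s, exponentialPDF 1 s * ENNReal.ofReal (Real.exp (-(c * s))) =
      ENNReal.ofReal (1 / (1 + c)) * exponentialPDF (1 + c) s := by
    intro s
    rcases lt_or_ge s 0 with hs | hs
    · simp [exponentialPDF_of_neg hs]
    · rw [exponentialPDF_of_nonneg hs, exponentialPDF_of_nonneg hs,
        ← ENNReal.ofReal_mul (by positivity), ← ENNReal.ofReal_mul (by positivity), ← mul_assoc,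
        one_div_mul_cancel h1.ne', one_mul, one_mul, ← Real.exp_add]
      ring_nf
  simp_rw [this]
  rw [lintegral_const_mul _ (measurable_exponentialPDF _), lintegral_exponentialPDF_eq_one h1,
    mul_one]

theorem lintegral_id_expMeasure_ne_top : ∫⁻ s, ENNReal.ofReal s ∂expMeasure 1 ≠ ∞ := by
  -- Uses `s ≤ 2 exp (s / 2)` and the Laplace transform at `c = -1/2`.
  refine ne_top_of_le_ne_top (b := ∫⁻ s, ENNReal.ofReal 2 * ENNReal.ofReal
    (Real.exp (-((-1 / 2) * s))) ∂expMeasure 1) ?_ (lintegral_mono fun s => ?_)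
  · rw [lintegral_const_mul _ (by fun_prop), lintegral_exp_neg_mul_expMeasure (by norm_num)]
    finiteness
  · rw [← ENNReal.ofReal_mul (by norm_num)]
    refine ENNReal.ofReal_le_ofReal ?_
    have := Real.add_one_le_exp (-((-1 / 2) * s))
    linarith

/-- Memorylessness: the minimum of two exponential clocks is attained by the first one with
probability `1 / (1 + c)`, and then the residual time of the second one is again exponential. -/
theorem lintegral_expMeasure_residual {c : ℝ} (hc : 0 ≤ c) {f : ℝ → ℝ≥0∞} (hf : Measurable f)
    (hf0 : ∀ u < 0, f u = 0) :
    ∫⁻ s, ∫⁻ t, f (t - c * s) ∂expMeasure 1 ∂expMeasure 1 =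
      ENNReal.ofReal (1 / (1 + c)) * ∫⁻ t, f t ∂expMeasure 1 := by
  have inner : ∀ s, 0 < s → ∫⁻ t, f (t - c * s) ∂expMeasure 1 =
      ENNReal.ofReal (Real.exp (-(c * s))) * ∫⁻ t, f t ∂expMeasure 1 := by
    intro s hs
    have hcs : 0 ≤ c * s := by positivity
    -- Translate by `c * s` and use `exp (-t) = exp (-(c * s)) * exp (-(t - c * s))`; values of `t`
    -- below `c * s` do not contribute, by `hf0`.
    rw [lintegral_expMeasure (by fun_prop), lintegral_expMeasure hf,
      ← lintegral_const_mul (f := fun s => exponentialPDF 1 s * f s) _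
        ((measurable_exponentialPDF 1).mul hf),
      ← lintegral_sub_right_eq_self (fun u => ENNReal.ofReal (Real.exp (-(c * s))) *
        (exponentialPDF 1 u * f u)) (c * s)]
    refine lintegral_congr fun t => ?_
    rcases lt_or_ge (t - c * s) 0 with h | h
    · simp [hf0 _ h]
    · rw [exponentialPDF_of_nonneg h, exponentialPDF_of_nonneg (by linarith), ← mul_assoc,
        ← ENNReal.ofReal_mul (by positivity), one_mul, one_mul, one_mul, one_mul, ← Real.exp_add]
      ring_nf
  rw [lintegral_congr_ae (expMeasure_ae_pos.mono inner), lintegral_mul_const _ (by fun_prop),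
    lintegral_exp_neg_mul_expMeasure (by linarith)]

/-- The law of a field of independent standard exponential clocks. -/
noncomputable def clockLaw : Measure (ℤ × ℤ × ℕ → ℝ) :=
  Measure.infinitePi fun _ => expMeasure 1

instance : IsProbabilityMeasure clockLaw := by rw [clockLaw]; infer_instance

theorem clockLaw_map_comp {ψ : ℤ × ℤ × ℕ → ℤ × ℤ × ℕ} (hψ : Function.Injective ψ) :
    clockLaw.map (fun σ => σ ∘ ψ) = clockLaw := by
  have h := (iIndepFun_infinitePi (P := fun _ : ℤ × ℤ × ℕ => expMeasure 1)
    (X := fun _ s => s) (fun _ => measurable_id)).precomp hψ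
  have h' := h.map_fun_eq_infinitePi_map (fun i => by fun_prop)
  rw [clockLaw]
  refine h'.trans ?_
  congr 1
  funext i
  exact Measure.infinitePi_map_eval (fun _ : ℤ × ℤ × ℕ => expMeasure 1) (ψ i)

theorem measurable_update_clock (b : ℤ × ℤ × ℕ) :
    Measurable fun q : (ℤ × ℤ × ℕ → ℝ) × ℝ => Function.update q.1 b q.2 := by
  refine measurable_pi_iff.2 fun i => ?_
  by_cases hi : i = b
  · subst hi; simpa using measurable_snd
  · simp only [Function.update_of_ne hi]; fun_prop

/-- Resampling one coordinate independently preserves the product law; this isolates a single clock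
while the others are frozen. -/
theorem clockLaw_map_update (b : ℤ × ℤ × ℕ) :
    (clockLaw.prod (expMeasure 1)).map (fun q => Function.update q.1 b q.2) = clockLaw := by
  conv_rhs => rw [clockLaw]
  refine Measure.eq_infinitePi _ fun s t ht => ?_
  rw [Measure.map_apply (measurable_update_clock b) (MeasurableSet.pi s.countable_toSet fun i _ => ht i)]
  have : (fun q : (ℤ × ℤ × ℕ → ℝ) × ℝ => Function.update q.1 b q.2) ⁻¹' (Set.pi s t) =
      (Set.pi (s.erase b : Finset _) t) ×ˢ (if b ∈ s then t b else Set.univ) := by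
    ext ⟨σ, u⟩
    simp only [Set.mem_preimage, Set.mem_pi, Set.mem_prod, Finset.mem_coe, Finset.mem_erase]
    constructor
    · intro h
      refine ⟨fun i hi => by simpa [hi.1] using h i hi.2, ?_⟩
      split_ifs with hb
      · simpa using h b hb
      · trivial
    · rintro ⟨h1, h2⟩ i hi
      by_cases hib : i = b
      · subst hib; simpa [hi] using h2
      · simpa [hib] using h1 i ⟨hib, hi⟩
  rw [this, Measure.prod_prod, clockLaw, Measure.infinitePi_pi _ (fun i _ => ht i)]
  split_ifs with hb
  · rw [mul_comm, Finset.mul_prod_erase s (fun i => expMeasure 1 (t i)) hb]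
  · rw [measure_univ, mul_one, Finset.erase_eq_of_notMem hb]

theorem lintegral_clockLaw_update (b : ℤ × ℤ × ℕ) {f : (ℤ × ℤ × ℕ → ℝ) → ℝ≥0∞}
    (hf : Measurable f) :
    ∫⁻ σ, f σ ∂clockLaw = ∫⁻ σ, ∫⁻ t, f (Function.update σ b t) ∂expMeasure 1 ∂clockLaw := by
  conv_lhs => rw [← clockLaw_map_update b]
  rw [lintegral_map hf (measurable_update_clock b)]
  exact lintegral_prod _ (hf.comp (measurable_update_clock b)).aemeasurable

/-- Index map discarding the first clock in direction `e` at `y`. -/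
def popIndex (y e : ℤ) (i : ℤ × ℤ × ℕ) : ℤ × ℤ × ℕ :=
  if i.1 = y ∧ i.2.1 = e then (y, e, i.2.2 + 1) else i

theorem popIndex_injective (y e : ℤ) : Function.Injective (popIndex y e) := by
  rintro ⟨a, b, c⟩ ⟨a', b', c'⟩ h
  unfold popIndex at h
  simp only at h
  split_ifs at h <;> simp only [Prod.mk.injEq] at h ⊢ <;> omega

theorem popIndex_ne (y e : ℤ) (i : ℤ × ℤ × ℕ) : popIndex y e i ≠ (y, e, 0) := by
  unfold popIndex
  split_ifs with h
  · simp
  · rintro rfl; simp at h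

theorem popIndex_other {y e : ℤ} (he : e ≠ -e) (i : ℕ) :
    popIndex y e (y, -e, i) = (y, -e, i) := by
  unfold popIndex
  rw [if_neg]
  simp only [not_and]
  omega

/-- Residual clocks after the first clock in direction `e` at `y` has rung: this clock is discarded
and the clock in the opposite direction is decreased by `c` times its value. -/
noncomputable def advance (y e : ℤ) (c : ℝ) (σ : ℤ × ℤ × ℕ → ℝ) : ℤ × ℤ × ℕ → ℝ :=
  Function.update (σ ∘ popIndex y e) (y, -e, 0) (σ (y, -e, 0) - c * σ (y, e, 0))

theorem measurable_advance (y e : ℤ) (c : ℝ) : Measurable (advance y e c) := by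
  have h : Measurable fun σ : ℤ × ℤ × ℕ → ℝ =>
      (σ ∘ popIndex y e, σ (y, -e, 0) - c * σ (y, e, 0)) := by
    refine Measurable.prodMk (measurable_pi_iff.2 fun i => ?_) (by fun_prop)
    exact measurable_pi_apply _
  exact (measurable_update_clock (y, -e, 0)).comp h

/-- Isolate the two current clocks at `y` and apply memorylessness to them. The set `D` is free at
the null point `0` because a tie between the clocks is attributed to one direction only. -/
theorem clockLaw_advance {y e : ℤ} (he : e ≠ -e) {c : ℝ} (hc : 0 ≤ c) {D : Set ℝ}
    (hD : MeasurableSet D) (hD0 : Set.Ioi 0 ⊆ D) (hD1 : D ⊆ Set.Ici 0)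
    {B : Set (ℤ × ℤ × ℕ → ℝ)} (hB : MeasurableSet B) :
    clockLaw {σ | σ (y, -e, 0) - c * σ (y, e, 0) ∈ D ∧ advance y e c σ ∈ B} =
      ENNReal.ofReal (1 / (1 + c)) * clockLaw B := by
  have hne : (y, e, 0) ≠ (y, -e, (0 : ℕ)) := by simpa using he
  set a : ℤ × ℤ × ℕ := (y, e, 0)
  set b : ℤ × ℤ × ℕ := (y, -e, 0)
  have hcomp : Measurable fun σ : ℤ × ℤ × ℕ → ℝ => σ ∘ popIndex y e :=
    measurable_pi_iff.2 fun i => measurable_pi_apply _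
  have hset : MeasurableSet {σ | σ b - c * σ a ∈ D ∧ advance y e c σ ∈ B} :=
    ((by fun_prop : Measurable fun σ : ℤ × ℤ × ℕ → ℝ => σ b - c * σ a) hD).inter
      (measurable_advance y e c hB)
  rw [← lintegral_indicator_one hset, ← lintegral_indicator_one hB,
    lintegral_clockLaw_update a (measurable_one.indicator hset)]
  have step : ∀ s σ, ∫⁻ t, ({σ | σ b - c * σ a ∈ D ∧ advance y e c σ ∈ B}.indicator 1
      (Function.update (Function.update σ a s) b t) : ℝ≥0∞) ∂expMeasure 1 =
      ∫⁻ t, (D.indicator 1 (t - c * s) * B.indicator 1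
        (Function.update (σ ∘ popIndex y e) b (t - c * s)) : ℝ≥0∞) ∂expMeasure 1 := by
    intro s σ
    refine lintegral_congr fun t => ?_
    -- `popIndex` never takes the value `a`, so the new field depends on the clock that rang only
    -- through `t - c * s`.
    have hadv : advance y e c (Function.update (Function.update σ a s) b t) =
        Function.update (σ ∘ popIndex y e) b (t - c * s) := by
      unfold advance
      funext i
      by_cases hi : i = b
      · subst hi
        rw [Function.update_self, Function.update_self, Function.update_self,
          Function.update_of_ne hne, Function.update_self]
      · rw [Function.update_of_ne hi, Function.update_of_ne hi, Function.comp, Function.comp,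
          Function.update_of_ne, Function.update_of_ne (popIndex_ne y e i)]
        intro h
        exact hi (popIndex_injective y e (h.trans (popIndex_other he 0).symm))
    simp only [Set.indicator, Set.mem_ofPred_eq, hadv, Function.update_self,
      Function.update_of_ne hne, Pi.one_apply]
    split_ifs <;> simp_all
  have hmD : Measurable (D.indicator 1 : ℝ → ℝ≥0∞) := measurable_one.indicator hD
  have hmB : Measurable (B.indicator 1 : (ℤ × ℤ × ℕ → ℝ) → ℝ≥0∞) := measurable_one.indicator hB
  have hmu : ∀ σ : ℤ × ℤ × ℕ → ℝ, Measurable fun t : ℝ => Function.update σ b t := fun σ =>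
    (measurable_update_clock b).comp (by fun_prop : Measurable fun t : ℝ => (σ, t))
  have hmeas2 : Measurable fun q : (ℤ × ℤ × ℕ → ℝ) × ℝ =>
      Function.update q.1 a q.2 := measurable_update_clock a
  have swap : ∫⁻ σ, ∫⁻ s, ({σ | σ b - c * σ a ∈ D ∧ advance y e c σ ∈ B}.indicator 1
        (Function.update σ a s) : ℝ≥0∞) ∂expMeasure 1 ∂clockLaw =
      ∫⁻ s, ∫⁻ σ, ({σ | σ b - c * σ a ∈ D ∧ advance y e c σ ∈ B}.indicator 1
        (Function.update σ a s) : ℝ≥0∞) ∂clockLaw ∂expMeasure 1 :=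
    lintegral_lintegral_swap ((measurable_one.indicator hset).comp hmeas2).aemeasurable
  rw [swap]
  have step2 : ∀ s, ∫⁻ σ, ({σ | σ b - c * σ a ∈ D ∧ advance y e c σ ∈ B}.indicator 1
        (Function.update σ a s) : ℝ≥0∞) ∂clockLaw =
      ∫⁻ σ, ∫⁻ t, (D.indicator 1 (t - c * s) * B.indicator 1
        (Function.update (σ ∘ popIndex y e) b (t - c * s)) : ℝ≥0∞) ∂expMeasure 1 ∂clockLaw := by
    intro s
    refine (lintegral_clockLaw_update b ((measurable_one.indicator hset).comp
      (hmeas2.comp (by fun_prop : Measurable fun σ : ℤ × ℤ × ℕ → ℝ => (σ, s))))).trans ?_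
    refine lintegral_congr fun σ => ?_
    rw [← step s σ]
    refine lintegral_congr fun t => ?_
    rw [Function.comp, Function.comp, Function.update_comm hne.symm]
  simp_rw [step2]
  rw [lintegral_lintegral_swap]
  swap
  · refine Measurable.aemeasurable (Measurable.lintegral_prod_right' (f := fun q :
      (ℝ × (ℤ × ℤ × ℕ → ℝ)) × ℝ => (D.indicator 1 (q.2 - c * q.1.1) * B.indicator 1
        (Function.update (q.1.2 ∘ popIndex y e) b (q.2 - c * q.1.1)) : ℝ≥0∞)) ?_)
    refine (hmD.comp (by fun_prop)).mul (hmB.comp ((measurable_update_clock b).comp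
      (Measurable.prodMk (hcomp.comp (by fun_prop)) (by fun_prop))))
  have step3 : ∀ σ : ℤ × ℤ × ℕ → ℝ, ∫⁻ s, ∫⁻ t, (D.indicator 1 (t - c * s) * B.indicator 1
        (Function.update (σ ∘ popIndex y e) b (t - c * s)) : ℝ≥0∞) ∂expMeasure 1 ∂expMeasure 1 =
      ENNReal.ofReal (1 / (1 + c)) *
        ∫⁻ t, B.indicator 1 (Function.update (σ ∘ popIndex y e) b t) ∂expMeasure 1 := by
    intro σ
    rw [lintegral_expMeasure_residual hc (f := fun u => D.indicator 1 u * B.indicator 1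
        (Function.update (σ ∘ popIndex y e) b u)) (hmD.mul (hmB.comp (hmu _))) ?_]
    · congr 1
      refine lintegral_congr_ae (expMeasure_ae_pos.mono fun t ht => ?_)
      simp [Set.indicator_of_mem (hD0 ht)]
    · intro u hu
      rw [Set.indicator_of_notMem (fun h => absurd (hD1 h) (by simpa using hu)), zero_mul]
  simp_rw [step3]
  have hmI : Measurable fun σ : ℤ × ℤ × ℕ → ℝ =>
      ∫⁻ t, (B.indicator 1 (Function.update σ b t) : ℝ≥0∞) ∂expMeasure 1 :=
    Measurable.lintegral_prod_right' (f := fun q : (ℤ × ℤ × ℕ → ℝ) × ℝ =>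
      (B.indicator 1 (Function.update q.1 b q.2) : ℝ≥0∞)) (hmB.comp (measurable_update_clock b))
  refine (lintegral_const_mul _ (hmI.comp hcomp)).trans ?_
  rw [lintegral_clockLaw_update b hmB]
  congr 1
  conv_rhs => rw [← clockLaw_map_comp (popIndex_injective y e)]
  exact (lintegral_map hmI hcomp).symm

/-! ### The walk built from residual clocks -/

instance instMeasurableSpaceHistory : MeasurableSpace (List ℤ) := ⊤

instance : DiscreteMeasurableSpace (List ℤ) := ⟨fun _ => trivial⟩

section Dynamics

variable (w : ℕ → ℝ)

/-- Weight of the neighbour in direction `e` of the current site, for a walk whose trajectory in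
reverse order is `l`. -/
def rate (l : List ℤ) (e : ℤ) : ℝ := w (l.count (l.headD 0 + e))

/-- Direction of the clock ringing first at the current site. -/
noncomputable def heading (l : List ℤ) (σ : ℤ × ℤ × ℕ → ℝ) : ℤ :=
  -- This compares `σ / rate` in the two directions, written through the residual of the left clock;
  -- ties go to the right.
  if 0 ≤ σ (l.headD 0, -1, 0) - rate w l (-1) / rate w l 1 * σ (l.headD 0, 1, 0) then 1 else -1

/-- Time elapsed at the current site before the first clock rings. -/
noncomputable def elapsed (l : List ℤ) (σ : ℤ × ℤ × ℕ → ℝ) : ℝ :=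
  σ (l.headD 0, heading w l σ, 0) / rate w l (heading w l σ)

/-- One step of the walk driven by clocks, on pairs (reversed trajectory, residual clocks). -/
noncomputable def nextState (s : List ℤ × (ℤ × ℤ × ℕ → ℝ)) : List ℤ × (ℤ × ℤ × ℕ → ℝ) :=
  ((s.1.headD 0 + heading w s.1 s.2) :: s.1,
    advance (s.1.headD 0) (heading w s.1 s.2)
      (rate w s.1 (-heading w s.1 s.2) / rate w s.1 (heading w s.1 s.2)) s.2)

/-- State at time `n` of the walk driven by the clocks `ρ`. -/
noncomputable def state (n : ℕ) (ρ : ℤ × ℤ × ℕ → ℝ) : List ℤ × (ℤ × ℤ × ℕ → ℝ) :=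
  (nextState w)^[n] ([0], ρ)

/-- The walk driven by the clocks `ρ`. -/
noncomputable def walk (ρ : ℤ × ℤ × ℕ → ℝ) (n : ℕ) : ℤ := (state w n ρ).1.headD 0

/-- Total clock time elapsed at `y` before step `n`. -/
noncomputable def clock (ρ : ℤ × ℤ × ℕ → ℝ) (n : ℕ) (y : ℤ) : ℝ :=
  ∑ k ∈ Finset.range n,
    if walk w ρ k = y then elapsed w (state w k ρ).1 (state w k ρ).2 else 0

/-- Transition probability of the reinforced walk with reversed trajectory `l`. -/
noncomputable def stepProb (l : List ℤ) (e : ℤ) : ℝ≥0∞ :=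
  if e = 1 ∨ e = -1 then ENNReal.ofReal (rate w l e / (rate w l 1 + rate w l (-1))) else 0

/-- Probability that the reinforced walk follows the reversed trajectory `l`. -/
noncomputable def histProb : List ℤ → ℝ≥0∞
  | [] => 0
  | [z] => if z = 0 then 1 else 0
  | z' :: z :: l => histProb (z :: l) * stepProb w (z :: l) (z' - z)

variable {w}

theorem heading_eq (l : List ℤ) (σ : ℤ × ℤ × ℕ → ℝ) :
    heading w l σ = 1 ∨ heading w l σ = -1 := by
  unfold heading; split_ifs <;> simp

theorem rate_pos (hw : ∀ n, 0 < w n) (l : List ℤ) (e : ℤ) : 0 < rate w l e := hw _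

theorem elapsed_le (hw : ∀ n, 0 < w n) (l : List ℤ) (σ : ℤ × ℤ × ℕ → ℝ) {e : ℤ}
    (he : e = 1 ∨ e = -1) : elapsed w l σ ≤ σ (l.headD 0, e, 0) / rate w l e := by
  have h1 := rate_pos hw l 1
  have h2 := rate_pos hw l (-1)
  unfold elapsed heading
  split_ifs with h
  · rcases he with rfl | rfl
    · exact le_rfl
    · rw [div_mul_eq_mul_div, sub_nonneg, div_le_iff₀ h1] at h
      rw [div_le_div_iff₀ h1 h2]; linarith
  · rcases he with rfl | rfl
    · rw [div_mul_eq_mul_div, not_le, sub_neg, lt_div_iff₀ h1] at h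
      rw [div_le_div_iff₀ h2 h1]; linarith
    · exact le_rfl

theorem measurable_heading (l : List ℤ) : Measurable (heading w l) := by
  unfold heading
  refine Measurable.ite ?_ measurable_const measurable_const
  exact measurableSet_le measurable_const (by fun_prop)

theorem measurable_nextState : Measurable (nextState w) := by
  refine measurable_from_prod_countable_right fun l => ?_
  have hd : MeasurableSet {σ | heading w l σ = 1} := measurable_heading l (measurableSet_singleton 1)
  have : (fun σ => nextState w (l, σ)) = fun σ => if heading w l σ = 1 then
      ((l.headD 0 + 1) :: l, advance (l.headD 0) 1 (rate w l (-1) / rate w l 1) σ) else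
      ((l.headD 0 + -1) :: l, advance (l.headD 0) (-1) (rate w l (- -1) / rate w l (-1)) σ) := by
    funext σ
    unfold nextState
    rcases heading_eq (w := w) l σ with h | h <;> simp [h]
  rw [this]
  exact Measurable.ite hd (measurable_const.prodMk (measurable_advance _ _ _))
    (measurable_const.prodMk (measurable_advance _ _ _))

theorem measurable_state (n : ℕ) : Measurable (state w n) :=
  (measurable_nextState.iterate n).comp (measurable_const.prodMk measurable_id)

theorem measurable_walk : Measurable (walk w) :=
  measurable_pi_iff.2 fun n =>
    (measurable_of_countable fun l : List ℤ => l.headD 0).comp (measurable_state n).fst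

theorem state_succ (n : ℕ) (ρ : ℤ × ℤ × ℕ → ℝ) : state w (n + 1) ρ = nextState w (state w n ρ) :=
  Function.iterate_succ_apply' _ _ _

theorem hist_succ (n : ℕ) (ρ : ℤ × ℤ × ℕ → ℝ) :
    (state w (n + 1) ρ).1 = walk w ρ (n + 1) :: (state w n ρ).1 := by
  rw [walk, state_succ]; rfl

theorem walk_zero (ρ : ℤ × ℤ × ℕ → ℝ) : walk w ρ 0 = 0 := rfl

theorem walk_succ (n : ℕ) (ρ : ℤ × ℤ × ℕ → ℝ) :
    walk w ρ (n + 1) = walk w ρ n + heading w (state w n ρ).1 (state w n ρ).2 := by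
  rw [walk, state_succ]; rfl

theorem count_hist (n : ℕ) (ρ : ℤ × ℤ × ℕ → ℝ) (y : ℤ) :
    (state w n ρ).1.count y = visits (walk w ρ) n y := by
  induction n with
  | zero =>
    simp only [visits, zero_add, Finset.range_one, Finset.sum_singleton, walk_zero]
    change List.count y [0] = _
    rw [List.count_singleton]
    by_cases h : (0 : ℤ) = y <;> simp [h]
  | succ n ih => rw [hist_succ, List.count_cons, ih, visits_succ]; simp

theorem rate_hist (n : ℕ) (ρ : ℤ × ℤ × ℕ → ℝ) (e : ℤ) :
    rate w (state w n ρ).1 e = w (visits (walk w ρ) n (walk w ρ n + e)) := by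
  rw [rate, count_hist]; rfl

theorem clock_succ (ρ : ℤ × ℤ × ℕ → ℝ) (n : ℕ) (y : ℤ) :
    clock w ρ (n + 1) y = clock w ρ n y +
      if walk w ρ n = y then elapsed w (state w n ρ).1 (state w n ρ).2 else 0 := by
  rw [clock, Finset.sum_range_succ, clock]

theorem advance_pop (y e : ℤ) (he : e ≠ -e) (c : ℝ) (σ : ℤ × ℤ × ℕ → ℝ) (i : ℕ) :
    advance y e c σ (y, e, i) = σ (y, e, i + 1) := by
  rw [advance, Function.update_of_ne (by simp [he]), Function.comp, popIndex, if_pos ⟨rfl, rfl⟩]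

theorem advance_opposite_zero (y e : ℤ) (c : ℝ) (σ : ℤ × ℤ × ℕ → ℝ) :
    advance y e c σ (y, -e, 0) = σ (y, -e, 0) - c * σ (y, e, 0) := by
  rw [advance, Function.update_self]

theorem advance_opposite_succ (y e : ℤ) (he : e ≠ -e) (c : ℝ) (σ : ℤ × ℤ × ℕ → ℝ) (i : ℕ) :
    advance y e c σ (y, -e, i + 1) = σ (y, -e, i + 1) := by
  rw [advance, Function.update_of_ne (by simp), Function.comp, popIndex_other he]

theorem advance_other {y z : ℤ} (hyz : y ≠ z) (e e' : ℤ) (c : ℝ) (σ : ℤ × ℤ × ℕ → ℝ) (i : ℕ) :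
    advance z e c σ (y, e', i) = σ (y, e', i) := by
  rw [advance, Function.update_of_ne (by simp [hyz]), Function.comp, popIndex,
    if_neg (by simp [hyz])]

/-- The part of the current clock already consumed is the weight of `y + e` times the clock time at
`y` since the last ring. The weight can change only while the path is on the `e` side of `y`, and
there no clock time has elapsed since that ring, which is the third clause. -/
theorem state_invariant (hw : ∀ n, 0 < w n) (ρ : ℤ × ℤ × ℕ → ℝ) (n : ℕ) (y e : ℤ)
    (he : e = 1 ∨ e = -1) :
    (∀ i, (state w n ρ).2 (y, e, i + 1) = ρ (y, e, i + 1 + jumps (walk w ρ) e n y)) ∧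
    ρ (y, e, jumps (walk w ρ) e n y) - (state w n ρ).2 (y, e, 0) =
      w (visits (walk w ρ) n (y + e)) * (clock w ρ n y - alarm w ρ (walk w ρ) e n y) ∧
    (0 < e * (walk w ρ n - y) → clock w ρ n y = alarm w ρ (walk w ρ) e n y) := by
  induction n with
  | zero => simp [jumps_zero, clock, alarm, state]
  | succ n ih =>
    obtain ⟨i1, i2, i3⟩ := ih
    have hsucc := walk_succ (w := w) n ρ
    set l := (state w n ρ).1 with hl
    set σ := (state w n ρ).2 with hσ
    set p := walk w ρ with hp
    set d := heading w l σ with hd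
    have hdd : d = 1 ∨ d = -1 := heading_eq l σ
    have hd0 : d ≠ -d := by omega
    have hfield : (state w (n + 1) ρ).2 = advance (p n) d (rate w l (-d) / rate w l d) σ := by
      rw [state_succ]; rfl
    have hrate : ∀ e, rate w l e = w (visits p n (p n + e)) := rate_hist n ρ
    have hel : elapsed w l σ = σ (p n, d, 0) / rate w l d := rfl
    rw [hfield, clock_succ, alarm_succ, jumps_succ, visits_succ, ← hp, ← hl, ← hσ, hel]
    by_cases hy : p n = y
    · by_cases hed : e = d
      · have hJ : IsJump p e y n := ⟨hy, by rw [hsucc, hy, hed]⟩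
        rw [← hed] at hd0 ⊢
        rw [if_pos hJ, if_pos hJ, if_pos hy, hrate, hrate, hy]
        have hwp := hw (visits p n (y + e))
        have key : clock w ρ n y + σ (y, e, 0) / w (visits p n (y + e)) =
            alarm w ρ p e n y + ρ (y, e, jumps p e n y) / w (visits p n (y + e)) := by
          field_simp
          linarith
        refine ⟨fun i => ?_, ?_, fun _ => key⟩
        · rw [advance_pop _ _ hd0, i1]; congr 3; omega
        · rw [advance_pop _ _ hd0, i1, key, sub_self, mul_zero, sub_eq_zero]
          congr 3; omega
      · have hed' : e = -d := by omega
        have hJ : ¬ IsJump p e y n := fun h => by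
          have := h.2; rw [hsucc, hy] at this; omega
        have hv : ¬ p (n + 1) = y + e := by rw [hsucc, hy]; omega
        rw [if_neg hJ, if_neg hJ, if_pos hy, if_neg hv, hrate, hrate, hy, add_zero, add_zero,
          add_zero]
        refine ⟨fun i => ?_, ?_, fun h => ?_⟩
        · rw [hed', advance_opposite_succ _ _ hd0, ← hed', i1]
        · rw [hed', advance_opposite_zero, ← hed']
          have := hw (visits p n (y + d))
          have e1 : w (visits p n (y + e)) / w (visits p n (y + d)) * σ (y, d, 0) =
            w (visits p n (y + e)) * (σ (y, d, 0) / w (visits p n (y + d))) := by ring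
          rw [e1]
          linarith
        · exfalso
          rw [hsucc, hy, hed'] at h
          rcases hdd with h' | h' <;> rw [h'] at h <;> omega
    · have hJ : ¬ IsJump p e y n := fun h => hy h.1
      rw [if_neg hJ, if_neg hJ, if_neg hy, add_zero, add_zero, add_zero]
      refine ⟨fun i => ?_, ?_, fun h => i3 ?_⟩
      · rw [advance_other (Ne.symm hy), i1]
      · rw [advance_other (Ne.symm hy)]
        -- A step not starting at `y` can reach `y + e` only from the `e` side; otherwise the weight
        -- is unchanged.
        by_cases hpos : 0 < e * (p n - y)
        · rw [i2, i3 hpos, sub_self, mul_zero, mul_zero]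
        · rw [if_neg, add_zero, i2]
          rw [hsucc]
          rcases hdd with h' | h' <;> rw [h'] <;> rcases he with rfl | rfl <;> omega
      · rw [hsucc] at h
        rcases hdd with h' | h' <;> rw [h'] at h <;> rcases he with rfl | rfl <;> omega

theorem isClockPath_walk (hw : ∀ n, 0 < w n) {ρ : ℤ × ℤ × ℕ → ℝ}
    (hpos : ∀ n i, 0 < (state w n ρ).2 i) : IsClockPath w ρ (walk w ρ) (clock w ρ) where
  start := walk_zero ρ
  step n := by
    rw [walk_succ]
    rcases heading_eq (w := w) (state w n ρ).1 (state w n ρ).2 with h | h <;> rw [h]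
    · exact Or.inl rfl
    · exact Or.inr rfl
  mono y := monotone_nat_of_le_succ fun n => by
    rw [clock_succ]
    refine le_add_of_nonneg_right ?_
    split_ifs
    · exact (div_pos (hpos _ _) (rate_pos hw _ _)).le
    · exact le_rfl
  strict n := by
    rw [clock_succ, if_pos rfl]
    exact lt_add_of_pos_right _ (div_pos (hpos _ _) (rate_pos hw _ _))
  ring n e he h := by
    refine ((state_invariant hw ρ (n + 1) (walk w ρ n) e he).2.2 ?_).symm
    rw [h]
    rcases he with rfl | rfl <;> ring_nf <;> norm_num
  wait n e he := by
    have h := (state_invariant hw ρ n (walk w ρ n) e he).2.1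
    have hle := elapsed_le hw (state w n ρ).1 (state w n ρ).2 he
    rw [rate_hist] at hle
    change _ ≤ (state w n ρ).2 (walk w ρ n, e, 0) / _ at hle
    have hwp := hw (visits (walk w ρ) n (walk w ρ n + e))
    rw [clock_succ, if_pos rfl]
    have key : clock w ρ n (walk w ρ n) +
        (state w n ρ).2 (walk w ρ n, e, 0) / w (visits (walk w ρ) n (walk w ρ n + e)) =
        alarm w ρ (walk w ρ) e n (walk w ρ n) + ρ (walk w ρ n, e, jumps (walk w ρ) e n (walk w ρ n))
          / w (visits (walk w ρ) n (walk w ρ n + e)) := by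
      field_simp
      linarith
    linarith

end Dynamics

/-! ### Law of the trajectory and of the residual clocks -/

section Law

variable {w : ℕ → ℝ}

theorem clockLaw_step (hw : ∀ n, 0 < w n) (l : List ℤ) {e : ℤ} (he : e = 1 ∨ e = -1)
    {B : Set (ℤ × ℤ × ℕ → ℝ)} (hB : MeasurableSet B) :
    clockLaw {σ | heading w l σ = e ∧ advance (l.headD 0) e (rate w l (-e) / rate w l e) σ ∈ B} =
      stepProb w l e * clockLaw B := by
  have h1 := rate_pos hw l 1
  have h2 := rate_pos hw l (-1)
  rw [stepProb, if_pos he]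
  rcases he with rfl | rfl
  -- The closed half-line for a step right and the open one for a step left match the tie rule in
  -- `heading`.
  · have := clockLaw_advance (y := l.headD 0) (e := 1) (by norm_num) (div_pos h2 h1).le
      (D := Set.Ici 0) measurableSet_Ici Set.Ioi_subset_Ici_self subset_rfl hB
    convert this using 3
    · ext σ
      refine and_congr_left fun _ => ?_
      unfold heading
      simp only [Set.mem_Ici]
      split_ifs with h
      · exact iff_of_true rfl h
      · exact iff_of_false (by norm_num) h
    · field_simp
  · have := clockLaw_advance (y := l.headD 0) (e := -1) (by norm_num) (div_pos h1 h2).le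
      (D := Set.Ioi 0) measurableSet_Ioi subset_rfl Set.Ioi_subset_Ici_self hB
    convert this using 3
    · ext σ
      rw [neg_neg]
      refine and_congr_left fun _ => ?_
      unfold heading
      simp only [Set.mem_Ioi]
      have hiff : 0 < σ (l.headD 0, 1, 0) - rate w l 1 / rate w l (-1) * σ (l.headD 0, -1, 0) ↔
          ¬ 0 ≤ σ (l.headD 0, -1, 0) - rate w l (-1) / rate w l 1 * σ (l.headD 0, 1, 0) := by
        rw [div_mul_eq_mul_div, div_mul_eq_mul_div, sub_nonneg, sub_pos, div_le_iff₀ h1,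
          div_lt_iff₀ h2, not_le, mul_comm (rate w l 1), mul_comm (rate w l (-1))]
      rw [hiff]
      split_ifs with h
      · exact iff_of_false (by norm_num) (not_not.2 h)
      · exact iff_of_true rfl h
    · field_simp
      ring

/-- The induction must run over all `B`: the event of the next step is itself a condition on the
residual clocks at time `n`. -/
theorem clockLaw_state (hw : ∀ n, 0 < w n) (n : ℕ) (l : List ℤ) {B : Set (ℤ × ℤ × ℕ → ℝ)}
    (hB : MeasurableSet B) :
    clockLaw {ρ | (state w n ρ).1 = l ∧ (state w n ρ).2 ∈ B} =
      (if l.length = n + 1 then histProb w l else 0) * clockLaw B := by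
  induction n generalizing l B with
  | zero =>
    have hs : ∀ ρ, state w 0 ρ = ([0], ρ) := fun ρ => rfl
    simp only [hs]
    rcases l with _ | ⟨z, _ | ⟨z', l⟩⟩
    · simp
    · by_cases hz : z = 0
      · simp [hz, histProb]
      · simp [hz, Ne.symm hz, histProb]
    · simp
  | succ n ih =>
    rcases l with _ | ⟨z', t⟩
    · have : {ρ | (state w (n + 1) ρ).1 = [] ∧ (state w (n + 1) ρ).2 ∈ B} = ∅ := by
        ext ρ; simp [hist_succ]
      rw [this]; simp
    set e := z' - t.headD 0 with he
    have hset : {ρ | (state w (n + 1) ρ).1 = z' :: t ∧ (state w (n + 1) ρ).2 ∈ B} =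
        {ρ | (state w n ρ).1 = t ∧ (state w n ρ).2 ∈ {σ | heading w t σ = e ∧
          advance (t.headD 0) e (rate w t (-e) / rate w t e) σ ∈ B}} := by
      ext ρ
      simp only [Set.mem_ofPred_eq, state_succ, nextState, List.cons.injEq]
      constructor
      · rintro ⟨⟨h1, rfl⟩, h2⟩
        have h3 : heading w (state w n ρ).1 (state w n ρ).2 = e := by omega
        rw [h3] at h2
        exact ⟨rfl, h3, h2⟩
      · rintro ⟨rfl, h3, h2⟩
        rw [h3]
        exact ⟨⟨by omega, rfl⟩, h2⟩
    have hms : MeasurableSet {σ | heading w t σ = e ∧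
        advance (t.headD 0) e (rate w t (-e) / rate w t e) σ ∈ B} :=
      (measurable_heading t (measurableSet_singleton e)).inter (measurable_advance _ _ _ hB)
    rw [hset, ih t hms]
    have hstep : clockLaw {σ | heading w t σ = e ∧
        advance (t.headD 0) e (rate w t (-e) / rate w t e) σ ∈ B} =
        stepProb w t e * clockLaw B := by
      by_cases h : e = 1 ∨ e = -1
      · exact clockLaw_step hw t h hB
      · rw [stepProb, if_neg h, zero_mul]
        convert measure_empty (μ := clockLaw)
        ext σ
        simp only [Set.mem_ofPred_eq, Set.mem_empty_iff_false, iff_false, not_and]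
        intro h'
        exact absurd (h' ▸ heading_eq t σ) h
    rw [hstep]
    rcases t with _ | ⟨z, t⟩
    · simp
    · simp only [List.length_cons, add_left_inj]
      split_ifs
      · rw [histProb, mul_assoc]; rfl
      · simp

theorem clockLaw_hist (hw : ∀ n, 0 < w n) (n : ℕ) (l : List ℤ) :
    clockLaw {ρ | (state w n ρ).1 = l} = if l.length = n + 1 then histProb w l else 0 := by
  have := clockLaw_state hw n l MeasurableSet.univ
  simpa using this

/-- The residual clocks are independent of the trajectory and distributed as the initial ones. -/
theorem clockLaw_map_state (hw : ∀ n, 0 < w n) (n : ℕ) :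
    clockLaw.map (state w n) = (clockLaw.map fun ρ => (state w n ρ).1).prod clockLaw := by
  have hm := measurable_state (w := w) n
  have : IsProbabilityMeasure (clockLaw.map fun ρ => (state w n ρ).1) :=
    Measure.isProbabilityMeasure_map hm.fst.aemeasurable
  symm
  refine Measure.prod_eq fun s t hs ht => ?_
  rw [Measure.map_apply hm (hs.prod ht), Measure.map_apply hm.fst hs]
  have e1 : state w n ⁻¹' s ×ˢ t =
      ⋃ l ∈ s, {ρ | (state w n ρ).1 = l ∧ (state w n ρ).2 ∈ t} := by
    ext ρ; simp
  have e2 : (fun ρ => (state w n ρ).1) ⁻¹' s = ⋃ l ∈ s, {ρ | (state w n ρ).1 = l} := by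
    ext ρ; simp
  have hm1 : ∀ l, MeasurableSet {ρ | (state w n ρ).1 = l} := fun l =>
    hm.fst (measurableSet_singleton l)
  rw [e1, e2, measure_biUnion s.to_countable, measure_biUnion s.to_countable,
    ← ENNReal.tsum_mul_right]
  · refine tsum_congr fun l => ?_
    rw [clockLaw_state hw n l ht, clockLaw_hist hw]
  · intro l _ l' _ hne
    exact Set.disjoint_left.2 fun ρ h h' => hne (h.symm.trans h')
  · exact fun l _ => hm1 l
  · intro l _ l' _ hne
    exact Set.disjoint_left.2 fun ρ h h' => hne (h.1.symm.trans h'.1)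
  · exact fun l _ => (hm1 l).inter (hm.snd ht)

theorem clockLaw_ae_pos : ∀ᵐ σ ∂clockLaw, ∀ i, 0 < σ i := by
  rw [ae_all_iff]
  intro i
  have h : clockLaw.map (fun σ => σ i) = expMeasure 1 :=
    Measure.infinitePi_map_eval (fun _ : ℤ × ℤ × ℕ => expMeasure 1) i
  have := expMeasure_ae_pos
  rw [← h] at this
  exact ae_of_ae_map (measurable_pi_apply i).aemeasurable this

theorem ae_state_pos (hw : ∀ n, 0 < w n) :
    ∀ᵐ ρ ∂clockLaw, ∀ n i, 0 < (state w n ρ).2 i := by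
  rw [ae_all_iff]
  intro n
  have hm := measurable_state (w := w) n
  have : IsProbabilityMeasure (clockLaw.map fun ρ => (state w n ρ).1) :=
    Measure.isProbabilityMeasure_map hm.fst.aemeasurable
  have h : clockLaw.map (fun ρ => (state w n ρ).2) = clockLaw := by
    have := congrArg (Measure.map Prod.snd) (clockLaw_map_state hw n)
    rwa [Measure.map_map measurable_snd hm, Measure.map_snd_prod, measure_univ, one_smul] at this
  have := clockLaw_ae_pos
  rw [← h] at this
  exact ae_of_ae_map hm.snd.aemeasurable this

end Law

/-! ### Total clock time at a site is controlled by the compensator -/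

/-- Sum over the visits to `x` before time `n` of the inverse total weight of the neighbours. -/
noncomputable def compensator (w : ℕ → ℝ) (p : ℕ → ℤ) (x : ℤ) (n : ℕ) : ℝ :=
  ∑ k ∈ Finset.range n,
    if p k = x then 1 / (w (visits p k (x + 1)) + w (visits p k (x - 1))) else 0

section ElapsedTime

variable (w : ℕ → ℝ) (x : ℤ)

/-- Last term of the compensator along the reversed trajectory `l`. -/
noncomputable def compensatorTerm (l : List ℤ) : ℝ :=
  if l.headD 0 = x then 1 / (rate w l 1 + rate w l (-1)) else 0

/-- The compensator as a function of the reversed trajectory. -/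
noncomputable def compensatorHist : List ℤ → ℝ
  | [] => 0
  | z :: l => compensatorHist l + compensatorTerm w x (z :: l)

variable {w x}

theorem compensatorTerm_nonneg (hw : ∀ n, 0 < w n) (l : List ℤ) : 0 ≤ compensatorTerm w x l := by
  unfold compensatorTerm
  have h1 := rate_pos hw l 1
  have h2 := rate_pos hw l (-1)
  split_ifs <;> positivity

theorem compensator_walk_succ (ρ : ℤ × ℤ × ℕ → ℝ) (n : ℕ) :
    compensator w (walk w ρ) x (n + 1) =
      compensator w (walk w ρ) x n + compensatorTerm w x (state w n ρ).1 := by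
  rw [compensator, Finset.sum_range_succ, ← compensator, compensatorTerm]
  congr 1
  change _ = if walk w ρ n = x then _ else _
  split_ifs with h
  · rw [rate_hist, rate_hist, h]; rfl
  · rfl

/-- The history at time `n` already determines the term of time `n`, hence the index `n + 1`;
truncation at level `K` is thus an event of the history. -/
theorem compensator_walk_eq (ρ : ℤ × ℤ × ℕ → ℝ) (n : ℕ) :
    compensator w (walk w ρ) x (n + 1) = compensatorHist w x (state w n ρ).1 := by
  induction n with
  | zero =>
    rw [compensator_walk_succ]
    change _ = compensatorHist w x [] + compensatorTerm w x (state w 0 ρ).1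
    simp [compensator, compensatorHist]
  | succ n ih =>
    rw [compensator_walk_succ, ih, hist_succ, compensatorHist]

/-- The elapsed time is at most that of the faster clock, whose rate is at least half the total
rate. -/
theorem lintegral_elapsed_le (hw : ∀ n, 0 < w n) (l : List ℤ) :
    ∫⁻ σ, ENNReal.ofReal (elapsed w l σ) ∂clockLaw ≤
      2 * (∫⁻ s, ENNReal.ofReal s ∂expMeasure 1) *
        ENNReal.ofReal (1 / (rate w l 1 + rate w l (-1))) := by
  have h1 := rate_pos hw l 1
  have h2 := rate_pos hw l (-1)
  obtain ⟨e, he, hle⟩ : ∃ e : ℤ, (e = 1 ∨ e = -1) ∧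
      1 / rate w l e ≤ 2 * (1 / (rate w l 1 + rate w l (-1))) := by
    rcases le_total (rate w l 1) (rate w l (-1)) with h | h
    · refine ⟨-1, Or.inr rfl, ?_⟩
      rw [mul_one_div, div_le_div_iff₀ h2 (by positivity)]; linarith
    · refine ⟨1, Or.inl rfl, ?_⟩
      rw [mul_one_div, div_le_div_iff₀ h1 (by positivity)]; linarith
  have hmap : clockLaw.map (fun σ => σ (l.headD 0, e, 0)) = expMeasure 1 :=
    Measure.infinitePi_map_eval (fun _ : ℤ × ℤ × ℕ => expMeasure 1) _
  calc ∫⁻ σ, ENNReal.ofReal (elapsed w l σ) ∂clockLaw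
      ≤ ∫⁻ σ, ENNReal.ofReal (1 / rate w l e) * ENNReal.ofReal (σ (l.headD 0, e, 0)) ∂clockLaw := by
        refine lintegral_mono fun σ => ?_
        rw [← ENNReal.ofReal_mul (one_div_pos.2 (rate_pos hw l e)).le, one_div_mul_eq_div]
        exact ENNReal.ofReal_le_ofReal (elapsed_le hw l σ he)
    _ = ENNReal.ofReal (1 / rate w l e) * ∫⁻ s, ENNReal.ofReal s ∂expMeasure 1 := by
        rw [lintegral_const_mul _ (by fun_prop), ← hmap,
          lintegral_map (by fun_prop) (measurable_pi_apply _)]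
    _ ≤ ENNReal.ofReal (2 * (1 / (rate w l 1 + rate w l (-1)))) *
          ∫⁻ s, ENNReal.ofReal s ∂expMeasure 1 := by gcongr
    _ = _ := by
        rw [ENNReal.ofReal_mul (by norm_num)]
        simp only [ENNReal.ofReal_ofNat]
        ring

theorem measurable_elapsed : Measurable fun s : List ℤ × (ℤ × ℤ × ℕ → ℝ) =>
    elapsed w s.1 s.2 := by
  refine measurable_from_prod_countable_right fun l => ?_
  have : (fun σ => elapsed w l σ) = fun σ => if heading w l σ = 1 then
      σ (l.headD 0, 1, 0) / rate w l 1 else σ (l.headD 0, -1, 0) / rate w l (-1) := by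
    funext σ
    unfold elapsed
    rcases heading_eq (w := w) l σ with h | h <;> rw [h] <;> norm_num
  simp only [this]
  exact Measurable.ite (measurable_heading l (measurableSet_singleton 1)) (by fun_prop)
    (by fun_prop)

open Classical in
theorem lintegral_elapsed_state_le (hw : ∀ n, 0 < w n) (K : ℝ) (n : ℕ) :
    ∫⁻ ρ, (if (state w n ρ).1.headD 0 = x ∧ compensatorHist w x (state w n ρ).1 ≤ K then
        ENNReal.ofReal (elapsed w (state w n ρ).1 (state w n ρ).2) else 0) ∂clockLaw ≤
      2 * (∫⁻ s, ENNReal.ofReal s ∂expMeasure 1) *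
        ∫⁻ ρ, (if compensatorHist w x (state w n ρ).1 ≤ K then
          ENNReal.ofReal (compensatorTerm w x (state w n ρ).1) else 0) ∂clockLaw := by
  have hm := measurable_state (w := w) n
  have : IsProbabilityMeasure (clockLaw.map fun ρ => (state w n ρ).1) :=
    Measure.isProbabilityMeasure_map hm.fst.aemeasurable
  set F : List ℤ × (ℤ × ℤ × ℕ → ℝ) → ℝ≥0∞ := fun s =>
    if s.1.headD 0 = x ∧ compensatorHist w x s.1 ≤ K then ENNReal.ofReal (elapsed w s.1 s.2) else 0
    with hF
  have hFm : Measurable F := by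
    refine Measurable.ite ?_ measurable_elapsed.ennreal_ofReal measurable_const
    exact measurable_fst (MeasurableSet.of_discrete
      (s := {l : List ℤ | l.headD 0 = x ∧ compensatorHist w x l ≤ K}))
  set g : List ℤ → ℝ≥0∞ := fun l =>
    if compensatorHist w x l ≤ K then ENNReal.ofReal (compensatorTerm w x l) else 0 with hg
  have hgm : Measurable g := measurable_of_countable g
  calc ∫⁻ ρ, F (state w n ρ) ∂clockLaw = ∫⁻ s, F s ∂(clockLaw.map (state w n)) :=
        (lintegral_map hFm hm).symm
    _ = ∫⁻ l, ∫⁻ σ, F (l, σ) ∂clockLaw ∂(clockLaw.map fun ρ => (state w n ρ).1) := by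
        rw [clockLaw_map_state hw, lintegral_prod _ hFm.aemeasurable]
    _ ≤ ∫⁻ l, 2 * (∫⁻ s, ENNReal.ofReal s ∂expMeasure 1) * g l
          ∂(clockLaw.map fun ρ => (state w n ρ).1) := by
        refine lintegral_mono fun l => ?_
        simp only [hF, hg, compensatorTerm]
        by_cases h1 : l.headD 0 = x
        · by_cases h2 : compensatorHist w x l ≤ K
          · simp only [h1, h2, and_self, if_true]
            exact lintegral_elapsed_le hw l
          · simp [h2]
        · simp only [h1, false_and, if_false]
          simp
    _ = 2 * (∫⁻ s, ENNReal.ofReal s ∂expMeasure 1) * ∫⁻ ρ, g (state w n ρ).1 ∂clockLaw := by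
        rw [lintegral_const_mul _ hgm, lintegral_map hgm hm.fst]

open Classical in
theorem tsum_truncated_compensator_le (hw : ∀ n, 0 < w n) {K : ℝ} (hK : 0 ≤ K)
    (ρ : ℤ × ℤ × ℕ → ℝ) :
    ∑' n, (if compensatorHist w x (state w n ρ).1 ≤ K then
      ENNReal.ofReal (compensatorTerm w x (state w n ρ).1) else 0) ≤ ENNReal.ofReal K := by
  refine ENNReal.tsum_le_of_sum_range_le fun N => ?_
  have hnn : ∀ n, 0 ≤ (if compensatorHist w x (state w n ρ).1 ≤ K then
      compensatorTerm w x (state w n ρ).1 else 0) := fun n => by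
    split_ifs
    · exact compensatorTerm_nonneg hw _
    · exact le_rfl
  have e : ∀ n, (if compensatorHist w x (state w n ρ).1 ≤ K then
      ENNReal.ofReal (compensatorTerm w x (state w n ρ).1) else 0) = ENNReal.ofReal
      (if compensatorHist w x (state w n ρ).1 ≤ K then
      compensatorTerm w x (state w n ρ).1 else 0) := fun n => by
    split_ifs <;> simp
  simp_rw [e]
  rw [← ENNReal.ofReal_sum_of_nonneg fun n _ => hnn n]
  refine ENNReal.ofReal_le_ofReal ?_
  -- The second bound feeds the first: when a term is kept, the sum is at most the compensator
  -- including that term, hence at most `K`.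
  have key : ∑ n ∈ Finset.range N, (if compensatorHist w x (state w n ρ).1 ≤ K then
      compensatorTerm w x (state w n ρ).1 else 0) ≤ K ∧
      ∑ n ∈ Finset.range N, (if compensatorHist w x (state w n ρ).1 ≤ K then
      compensatorTerm w x (state w n ρ).1 else 0) ≤ compensator w (walk w ρ) x N := by
    induction N with
    | zero => simpa [compensator] using hK
    | succ N ih =>
      rw [Finset.sum_range_succ, compensator_walk_succ]
      have hc := compensator_walk_eq (w := w) (x := x) ρ N
      rw [compensator_walk_succ] at hc
      have h0 := compensatorTerm_nonneg (x := x) hw (state w N ρ).1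
      split_ifs with h <;> constructor <;> linarith [ih.1, ih.2]
  exact key.1

open Classical in
-- Given the history the residual clocks are fresh, so the expected time spent at `x` while the
-- compensator is at most `K` is at most a constant times `K`. A countable union over `K` concludes.
theorem ae_bddAbove_clock (hw : ∀ n, 0 < w n) (x : ℤ) :
    ∀ᵐ ρ ∂clockLaw, BddAbove (Set.range (compensator w (walk w ρ) x)) →
      BddAbove (Set.range fun n => clock w ρ n x) := by
  have hfin : ∀ K : ℕ, ∀ᵐ ρ ∂clockLaw,
      ∑' n, (if (state w n ρ).1.headD 0 = x ∧ compensatorHist w x (state w n ρ).1 ≤ K then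
        ENNReal.ofReal (elapsed w (state w n ρ).1 (state w n ρ).2) else 0) < ∞ := by
    intro K
    have hm : ∀ n, Measurable fun ρ : ℤ × ℤ × ℕ → ℝ =>
        (if (state w n ρ).1.headD 0 = x ∧ compensatorHist w x (state w n ρ).1 ≤ K then
        ENNReal.ofReal (elapsed w (state w n ρ).1 (state w n ρ).2) else 0) := fun n => by
      refine Measurable.ite ?_ (measurable_elapsed.comp (measurable_state n)).ennreal_ofReal
        measurable_const
      exact (measurable_state (w := w) n).fst (MeasurableSet.of_discrete
        (s := {l : List ℤ | l.headD 0 = x ∧ compensatorHist w x l ≤ K}))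
    refine ae_lt_top (Measurable.tsum hm) ?_
    rw [lintegral_tsum fun n => (hm n).aemeasurable]
    refine ne_top_of_le_ne_top ?_ (ENNReal.tsum_le_tsum fun n =>
      lintegral_elapsed_state_le hw (K : ℝ) n)
    rw [ENNReal.tsum_mul_left]
    refine ENNReal.mul_ne_top (ENNReal.mul_ne_top (by simp) lintegral_id_expMeasure_ne_top) ?_
    have hm' : ∀ n, Measurable fun ρ : ℤ × ℤ × ℕ → ℝ =>
        (if compensatorHist w x (state w n ρ).1 ≤ K then
          ENNReal.ofReal (compensatorTerm w x (state w n ρ).1) else 0) := fun n =>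
      (measurable_of_countable fun l : List ℤ => (if compensatorHist w x l ≤ K then
          ENNReal.ofReal (compensatorTerm w x l) else 0)).comp (measurable_state (w := w) n).fst
    rw [← lintegral_tsum fun n => (hm' n).aemeasurable]
    refine ne_top_of_le_ne_top (b := ∫⁻ _, ENNReal.ofReal K ∂clockLaw) ?_
      (lintegral_mono fun ρ => tsum_truncated_compensator_le hw (Nat.cast_nonneg K) ρ)
    simp
  rw [← ae_all_iff] at hfin
  filter_upwards [hfin, ae_state_pos hw] with ρ hρ hpos hb
  obtain ⟨C, hC⟩ := hb
  obtain ⟨K, hK⟩ := exists_nat_ge C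
  have hcond : ∀ n, compensatorHist w x (state w n ρ).1 ≤ K := fun n => by
    rw [← compensator_walk_eq]
    exact (hC ⟨n + 1, rfl⟩).trans hK
  have h := hρ K
  simp only [hcond, and_true] at h
  refine ⟨(∑' n, (if (state w n ρ).1.headD 0 = x then
    ENNReal.ofReal (elapsed w (state w n ρ).1 (state w n ρ).2) else 0)).toReal, ?_⟩
  rintro _ ⟨n, rfl⟩
  rw [← ENNReal.ofReal_le_iff_le_toReal h.ne]
  refine le_trans (le_of_eq ?_) (ENNReal.sum_le_tsum (Finset.range n))
  simp only [clock]
  rw [ENNReal.ofReal_sum_of_nonneg]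
  · refine Finset.sum_congr rfl fun k _ => ?_
    change ENNReal.ofReal (if walk w ρ k = x then _ else _) = if walk w ρ k = x then _ else _
    split_ifs <;> simp
  · intro k _
    split_ifs
    · exact (div_pos (hpos _ _) (rate_pos hw _ _)).le
    · exact le_rfl

end ElapsedTime

/-! ### The tie event is null for the clock-driven walk -/

/-- Paths visiting both neighbours of `x` infinitely often while the compensator at `x` stays
bounded. -/
def tiePaths (w : ℕ → ℝ) (x : ℤ) : Set (ℕ → ℤ) :=
  {p | (∀ N, ∃ n ≥ N, p n = x + 1) ∧ (∀ N, ∃ n ≥ N, p n = x - 1) ∧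
    BddAbove (Set.range (compensator w p x))}

theorem measurableSet_path_eq (k : ℕ) (y : ℤ) : MeasurableSet {p : ℕ → ℤ | p k = y} :=
  (by fun_prop : Measurable fun p : ℕ → ℤ => p k) (measurableSet_singleton y)

theorem measurable_visits (n : ℕ) (y : ℤ) : Measurable fun p : ℕ → ℤ => visits p n y := by
  unfold visits
  refine Finset.measurable_sum _ fun k _ => ?_
  exact Measurable.ite (measurableSet_path_eq k y) measurable_const
    measurable_const

theorem measurable_compensator (w : ℕ → ℝ) (x : ℤ) (n : ℕ) :
    Measurable fun p : ℕ → ℤ => compensator w p x n := by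
  unfold compensator
  refine Finset.measurable_sum _ fun k _ => ?_
  refine Measurable.ite (measurableSet_path_eq k x) ?_ measurable_const
  have h : ∀ y, Measurable fun p : ℕ → ℤ => w (visits p k y) := fun y =>
    (measurable_of_countable w).comp (measurable_visits k y)
  exact measurable_const.div ((h _).add (h _))

theorem measurableSet_tiePaths (w : ℕ → ℝ) (x : ℤ) : MeasurableSet (tiePaths w x) := by
  have h : ∀ z : ℤ, MeasurableSet {p : ℕ → ℤ | ∀ N, ∃ n ≥ N, p n = z} := fun z => by
    have : {p : ℕ → ℤ | ∀ N, ∃ n ≥ N, p n = z} = ⋂ N, ⋃ n, ⋃ (_ : n ≥ N), {p | p n = z} := by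
      ext p; simp
    rw [this]
    exact MeasurableSet.iInter fun N => MeasurableSet.iUnion fun n => MeasurableSet.iUnion fun _ =>
      measurableSet_path_eq n z
  exact (h _).inter ((h _).inter (measurableSet_bddAbove_range (measurable_compensator w x)))

theorem clockLaw_walk_tiePaths {w : ℕ → ℝ} (hw : ∀ n, 0 < w n) (hmono : Monotone w) (x : ℤ) :
    clockLaw (walk w ⁻¹' tiePaths w x) = 0 := by
  have hH : MeasurableSet (walk w ⁻¹' tiePaths w x) :=
    measurable_walk (measurableSet_tiePaths w x)
  set b : ℤ × ℤ × ℕ := (x, 1, 0)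
  have hgood : ∀ᵐ ρ ∂clockLaw, (∀ n i, 0 < (state w n ρ).2 i) ∧
      (BddAbove (Set.range (compensator w (walk w ρ) x)) →
        BddAbove (Set.range fun n => clock w ρ n x)) :=
    (ae_state_pos hw).and (ae_bddAbove_clock hw x)
  rw [← clockLaw_map_update b] at hgood
  have hgood' := Measure.ae_ae_of_ae_prod
    (ae_of_ae_map (measurable_update_clock b).aemeasurable hgood)
  rw [← lintegral_indicator_one hH,
    lintegral_clockLaw_update b (measurable_one.indicator hH)]
  rw [lintegral_eq_zero_iff']
  swap
  · exact (Measurable.lintegral_prod_right' (f := fun q : (ℤ × ℤ × ℕ → ℝ) × ℝ =>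
      ((walk w ⁻¹' tiePaths w x).indicator 1 (Function.update q.1 b q.2) : ℝ≥0∞))
      ((measurable_one.indicator hH).comp (measurable_update_clock b))).aemeasurable
  filter_upwards [hgood'] with σ hσ
  -- With all other clocks frozen, two distinct bad values of the clock `b` would contradict
  -- `not_both_tie`.
  have hsub : Set.Subsingleton {t | Function.update σ b t ∈ walk w ⁻¹' tiePaths w x ∧
      (∀ n i, 0 < (state w n (Function.update σ b t)).2 i) ∧
      (BddAbove (Set.range (compensator w (walk w (Function.update σ b t)) x)) →
        BddAbove (Set.range fun n => clock w (Function.update σ b t) n x))} := by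
    have main : ∀ t t', t < t' → ∀ ρ ρ', ρ = Function.update σ b t → ρ' = Function.update σ b t' →
        (walk w ρ ∈ tiePaths w x ∧ (∀ n i, 0 < (state w n ρ).2 i) ∧
          (BddAbove (Set.range (compensator w (walk w ρ) x)) →
          BddAbove (Set.range fun n => clock w ρ n x))) →
        (walk w ρ' ∈ tiePaths w x ∧ (∀ n i, 0 < (state w n ρ').2 i) ∧
          (BddAbove (Set.range (compensator w (walk w ρ') x)) →
          BddAbove (Set.range fun n => clock w ρ' n x))) → False := by
      rintro t t' htt ρ ρ' hρ hρ' ⟨⟨a1, a2, a3⟩, a4, a5⟩ ⟨⟨b1, b2, b3⟩, b4, b5⟩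
      refine not_both_tie hw hmono (isClockPath_walk hw a4) (isClockPath_walk hw b4)
        (a4 0) (b4 0) (x := x) (fun i hi => ?_) ?_ a1 a2 b1 b2 (a5 a3) (b5 b3)
      · rw [hρ, hρ', Function.update_of_ne hi, Function.update_of_ne hi]
      · rw [hρ, hρ']
        change Function.update σ b t b < Function.update σ b t' b
        simpa using htt
    rintro t ht t' ht'
    by_contra hne
    rcases lt_or_gt_of_ne hne with h | h
    · exact main t t' h _ _ rfl rfl ht ht'
    · exact main t' t h _ _ rfl rfl ht' ht
  have hae : ∀ᵐ t ∂expMeasure 1, t ∉ {t | Function.update σ b t ∈ walk w ⁻¹' tiePaths w x ∧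
      (∀ n i, 0 < (state w n (Function.update σ b t)).2 i) ∧
      (BddAbove (Set.range (compensator w (walk w (Function.update σ b t)) x)) →
        BddAbove (Set.range fun n => clock w (Function.update σ b t) n x))} :=
    measure_eq_zero_iff_ae_notMem.1 (hsub.measure_zero _)
  refine lintegral_eq_zero_of_ae_eq_zero ?_
  filter_upwards [hae, hσ] with t h1 h2
  exact Set.indicator_of_notMem (fun h => h1 ⟨h, h2⟩) _

/-! ### Centred jump indicators -/

section Innovation

variable {Ω : Type*}

/-- Transition probability in direction `e` at time `n`. -/
noncomputable def jumpProb (w : ℕ → ℝ) (X : ℕ → Ω → ℤ) (e : ℤ) (n : ℕ) (ω : Ω) : ℝ :=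
  w (localTime X n (X n ω + e) ω) /
    (w (localTime X n (X n ω + 1) ω) + w (localTime X n (X n ω - 1) ω))

/-- Indicator of a jump in direction `e` at time `n`, minus its conditional probability. -/
noncomputable def innovation (w : ℕ → ℝ) (X : ℕ → Ω → ℤ) (e : ℤ) (n : ℕ) (ω : Ω) : ℝ :=
  {ω | X (n + 1) ω = X n ω + e}.indicator (fun _ => (1 : ℝ)) ω - jumpProb w X e n ω

theorem jumpProb_nonneg {w : ℕ → ℝ} (hw : ∀ n, 0 < w n) (X : ℕ → Ω → ℤ) (e : ℤ) (n : ℕ) (ω : Ω) :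
    0 ≤ jumpProb w X e n ω :=
  div_nonneg (hw _).le (add_pos (hw _) (hw _)).le

theorem jumpProb_le_one {w : ℕ → ℝ} (hw : ∀ n, 0 < w n) (X : ℕ → Ω → ℤ) {e : ℤ}
    (he : e = 1 ∨ e = -1) (n : ℕ) (ω : Ω) : jumpProb w X e n ω ≤ 1 := by
  refine div_le_one_of_le₀ ?_ (add_pos (hw _) (hw _)).le
  rcases he with rfl | rfl
  · exact le_add_of_nonneg_right (hw _).le
  · exact le_add_of_nonneg_left (hw _).le

theorem abs_innovation_le {w : ℕ → ℝ} (hw : ∀ n, 0 < w n) (X : ℕ → Ω → ℤ) {e : ℤ} (he : e = 1 ∨ e = -1) (n : ℕ) (ω : Ω) :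
    |innovation w X e n ω| ≤ 1 := by
  have h1 := jumpProb_nonneg hw X e n ω
  have h2 := jumpProb_le_one hw X he n ω
  unfold innovation Set.indicator
  rw [abs_le]
  split_ifs <;> constructor <;> linarith

variable [MeasurableSpace Ω] {P : Measure Ω} {w : ℕ → ℝ} {X : ℕ → Ω → ℤ}

/-- The natural filtration of the walk. -/
abbrev IsVRRW.filtration (hX : IsVRRW P w X) : Filtration ℕ ‹MeasurableSpace Ω› :=
  Filtration.natural X (fun k => (hX.measurable k).stronglyMeasurable)

theorem IsVRRW.measurable_of_le (hX : IsVRRW P w X) {k n : ℕ} (hkn : k ≤ n) :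
    Measurable[hX.filtration n] (X k) :=
  ((Filtration.stronglyAdapted_natural fun k => (hX.measurable k).stronglyMeasurable) k).measurable.mono
    (hX.filtration.mono hkn) le_rfl

theorem IsVRRW.measurable_path (hX : IsVRRW P w X) : Measurable fun ω n => X n ω :=
  measurable_pi_iff.2 hX.measurable

theorem IsVRRW.measurable_localTime (hX : IsVRRW P w X) {k n : ℕ} (hkn : k ≤ n) (y : ℤ) :
    Measurable[hX.filtration n] (localTime X k y) := by
  change Measurable[hX.filtration n] fun ω => localTime X k y ω
  unfold localTime
  refine Finset.measurable_sum _ fun j hj => ?_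
  exact Measurable.ite (hX.measurable_of_le (by simp at hj; omega) (measurableSet_singleton y))
    measurable_const measurable_const

theorem IsVRRW.measurable_localTime_moving (hX : IsVRRW P w X) (n : ℕ) (e : ℤ) :
    Measurable[hX.filtration n] fun ω => w (localTime X n (X n ω + e) ω) := by
  have h : Measurable[hX.filtration n] fun ω => localTime X n (X n ω + e) ω := by
    unfold localTime
    refine Finset.measurable_sum _ fun j hj => ?_
    refine Measurable.ite ?_ measurable_const measurable_const
    exact measurableSet_eq_fun (hX.measurable_of_le (by simp at hj; omega))
      ((hX.measurable_of_le le_rfl).add_const e)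
  exact (measurable_of_countable w).comp h

theorem IsVRRW.measurable_jumpProb (hX : IsVRRW P w X) (e : ℤ) (n : ℕ) :
    Measurable[hX.filtration n] (jumpProb w X e n) :=
  (hX.measurable_localTime_moving n e).div ((hX.measurable_localTime_moving n 1).add
    (by simpa [sub_eq_add_neg] using hX.measurable_localTime_moving n (-1)))

theorem IsVRRW.measurableSet_jump (hX : IsVRRW P w X) (e : ℤ) (n : ℕ) :
    MeasurableSet {ω | X (n + 1) ω = X n ω + e} :=
  measurableSet_eq_fun (hX.measurable (n + 1)) ((hX.measurable n).add_const e)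

theorem IsVRRW.measurable_innovation (hX : IsVRRW P w X) (e : ℤ) (n : ℕ) :
    Measurable (innovation w X e n) :=
  (measurable_const.indicator (hX.measurableSet_jump e n)).sub
    ((hX.measurable_jumpProb e n).mono (hX.filtration.le n) le_rfl)

variable [IsProbabilityMeasure P]

theorem integrable_of_abs_le {f : Ω → ℝ} (hf : Measurable f) (C : ℝ) (h : ∀ ω, |f ω| ≤ C) :
    Integrable f P :=
  Integrable.of_bound hf.aestronglyMeasurable C (ae_of_all _ h)

theorem IsVRRW.integrable_innovation (hX : IsVRRW P w X) (hw : ∀ n, 0 < w n) {e : ℤ}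
    (he : e = 1 ∨ e = -1) (n : ℕ) : Integrable (innovation w X e n) P :=
  integrable_of_abs_le (hX.measurable_innovation e n) 1 (abs_innovation_le hw X he n)

theorem IsVRRW.condExp_mul_innovation (hX : IsVRRW P w X) (hw : ∀ n, 0 < w n) {e : ℤ}
    (he : e = 1 ∨ e = -1) {n : ℕ} {h : Ω → ℝ} (hm : Measurable[hX.filtration n] h) (C : ℝ)
    (hb : ∀ ω, |h ω| ≤ C) :
    P[h * innovation w X e n | hX.filtration n] =ᵐ[P] 0 := by
  have hle := hX.filtration.le n
  have hInt := hX.integrable_innovation hw he n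
  have hi1 : Integrable ({ω | X (n + 1) ω = X n ω + e}.indicator (fun _ => (1 : ℝ))) P :=
    (integrable_const 1).indicator (hX.measurableSet_jump e n)
  have hi2 : Integrable (jumpProb w X e n) P :=
    integrable_of_abs_le ((hX.measurable_jumpProb e n).mono hle le_rfl) 1 fun ω => by
      rw [abs_of_nonneg (jumpProb_nonneg hw X e n ω)]; exact jumpProb_le_one hw X he n ω
  have h0 : P[innovation w X e n | hX.filtration n] =ᵐ[P] 0 := by
    have e1 : P[innovation w X e n | hX.filtration n] =ᵐ[P]
        P[{ω | X (n + 1) ω = X n ω + e}.indicator (fun _ => (1 : ℝ)) | hX.filtration n] -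
          P[jumpProb w X e n | hX.filtration n] := condExp_sub hi1 hi2 _
    rw [condExp_of_stronglyMeasurable hle (hX.measurable_jumpProb e n).stronglyMeasurable hi2] at e1
    filter_upwards [e1, hX.transition n e he] with ω h1 h2
    rw [h1, Pi.sub_apply, h2]
    exact sub_self _
  filter_upwards [condExp_stronglyMeasurable_mul_of_bound hle hm.stronglyMeasurable hInt C
    (ae_of_all _ hb), h0] with ω h1 h2
  rw [h1, Pi.mul_apply, h2]
  simp

theorem IsVRRW.integral_mul_innovation (hX : IsVRRW P w X) (hw : ∀ n, 0 < w n) {e : ℤ}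
    (he : e = 1 ∨ e = -1) {n : ℕ} {h : Ω → ℝ} (hm : Measurable[hX.filtration n] h) (C : ℝ)
    (hb : ∀ ω, |h ω| ≤ C) : ∫ ω, h ω * innovation w X e n ω ∂P = 0 := by
  have := integral_condExp (μ := P) (f := h * innovation w X e n) (hX.filtration.le n)
  rw [integral_congr_ae (hX.condExp_mul_innovation hw he hm C hb)] at this
  simpa using this.symm

end Innovation

/-! ### The reinforced walk has the law of the clock-driven walk -/

section PathLaw

/-- Trajectory up to time `n`, in reverse order. -/
def histOf (p : ℕ → ℤ) : ℕ → List ℤ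
  | 0 => [p 0]
  | n + 1 => p (n + 1) :: histOf p n

theorem headD_histOf (p : ℕ → ℤ) (n : ℕ) : (histOf p n).headD 0 = p n := by
  cases n <;> rfl

theorem histOf_ne_nil (p : ℕ → ℤ) (n : ℕ) : histOf p n ≠ [] := by
  cases n <;> simp [histOf]

theorem drop_histOf (p : ℕ → ℤ) (n k : ℕ) : (histOf p (n + k)).drop k = histOf p n := by
  induction k with
  | zero => rfl
  | succ k ih => rw [← add_assoc, histOf, List.drop_succ_cons, ih]

theorem count_histOf (p : ℕ → ℤ) (n : ℕ) (y : ℤ) : (histOf p n).count y = visits p n y := by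
  induction n with
  | zero =>
    simp only [visits, zero_add, Finset.range_one, Finset.sum_singleton, histOf,
      List.count_singleton]
    by_cases h : p 0 = y <;> simp [h]
  | succ n ih => rw [histOf, List.count_cons, ih, visits_succ]; simp

theorem rate_histOf (w : ℕ → ℝ) (p : ℕ → ℤ) (n : ℕ) (e : ℤ) :
    rate w (histOf p n) e = w (visits p n (p n + e)) := by
  rw [rate, count_histOf, headD_histOf]

theorem histOf_walk (w : ℕ → ℝ) (ρ : ℤ × ℤ × ℕ → ℝ) (n : ℕ) :
    histOf (walk w ρ) n = (state w n ρ).1 := by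
  induction n with
  | zero => rfl
  | succ n ih => rw [histOf, ih, hist_succ]

theorem measurable_histOf (n : ℕ) : Measurable fun p : ℕ → ℤ => histOf p n := by
  induction n with
  | zero =>
    exact (measurable_of_countable fun z : ℤ => [z]).comp
      (by fun_prop : Measurable fun p : ℕ → ℤ => p 0)
  | succ n ih =>
    exact (measurable_of_countable fun q : ℤ × List ℤ => q.1 :: q.2).comp
      ((by fun_prop : Measurable fun p : ℕ → ℤ => p (n + 1)).prodMk ih)

theorem ext_of_histOf {μ ν : Measure (ℕ → ℤ)} [IsProbabilityMeasure μ] [IsProbabilityMeasure ν]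
    (h : ∀ n l, μ {p | histOf p n = l} = ν {p | histOf p n = l}) : μ = ν := by
  set C : Set (Set (ℕ → ℤ)) := {S | ∃ n, ∃ A : Set (List ℤ), S = {p | histOf p n ∈ A}} with hC
  have hgen : (inferInstance : MeasurableSpace (ℕ → ℤ)) = MeasurableSpace.generateFrom C := by
    refine le_antisymm ?_ (MeasurableSpace.generateFrom_le ?_)
    · refine iSup_le fun n => ?_
      rintro _ ⟨B, -, rfl⟩
      refine MeasurableSpace.measurableSet_generateFrom ⟨n, {l | l.headD 0 ∈ B}, ?_⟩
      ext p
      simp only [Set.mem_preimage, Set.mem_ofPred_eq, headD_histOf]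
    · rintro _ ⟨n, A, rfl⟩
      exact measurable_histOf n (MeasurableSet.of_discrete (s := A))
  have hpi : IsPiSystem C := by
    rintro _ ⟨n, A, rfl⟩ _ ⟨m, B, rfl⟩ -
    -- Both histories are recovered from the one at time `n + m` by dropping the most recent
    -- positions.
    refine ⟨n + m, {l | l.drop m ∈ A ∧ l.drop n ∈ B}, ?_⟩
    ext p
    have h1 := drop_histOf p n m
    have h2 := drop_histOf p m n
    rw [add_comm] at h2
    simp only [Set.mem_inter_iff, Set.mem_ofPred_eq, h1, h2]
  refine ext_of_generate_finite C hgen hpi ?_ (by simp)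
  rintro _ ⟨n, A, rfl⟩
  have e : {p : ℕ → ℤ | histOf p n ∈ A} = ⋃ l ∈ A, {p | histOf p n = l} := by ext p; simp
  have hd : A.PairwiseDisjoint fun l => {p : ℕ → ℤ | histOf p n = l} := fun l _ l' _ hne =>
    Set.disjoint_left.2 fun p h h' => hne (h.symm.trans h')
  have hm : ∀ l ∈ A, MeasurableSet {p : ℕ → ℤ | histOf p n = l} := fun l _ =>
    measurable_histOf n (measurableSet_singleton l)
  rw [e, measure_biUnion A.to_countable hd hm, measure_biUnion A.to_countable hd hm]
  simp_rw [h]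

variable {Ω : Type*} [MeasurableSpace Ω] {P : Measure Ω} {w : ℕ → ℝ} {X : ℕ → Ω → ℤ}

theorem IsVRRW.measurableSet_histOf_eq (hX : IsVRRW P w X) (n : ℕ) (l : List ℤ) :
    MeasurableSet[hX.filtration n] {ω | histOf (fun k => X k ω) n = l} := by
  have : ∀ k ≤ n, Measurable[hX.filtration n] fun ω => histOf (fun k => X k ω) k := by
    intro k
    induction k with
    | zero =>
      intro h
      exact (measurable_of_countable fun z : ℤ => [z]).comp (hX.measurable_of_le h)
    | succ k ih =>
      intro h
      exact (measurable_of_countable fun q : ℤ × List ℤ => q.1 :: q.2).comp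
        ((hX.measurable_of_le h).prodMk (ih (by omega)))
  exact this n le_rfl (measurableSet_singleton l)

variable [IsProbabilityMeasure P]

theorem IsVRRW.measure_histOf (hX : IsVRRW P w X) (hw : ∀ n, 0 < w n) (n : ℕ) (l : List ℤ) :
    P {ω | histOf (fun k => X k ω) n = l} = if l.length = n + 1 then histProb w l else 0 := by
  induction n generalizing l with
  | zero =>
    rcases l with _ | ⟨z, _ | ⟨z', l⟩⟩
    · simp [histOf]
    · have h0 : ∀ᵐ ω ∂P, (histOf (fun k => X k ω) 0 = [z]) ↔ (0 = z) := by
        filter_upwards [hX.start] with ω h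
        simp [histOf, h]
      have : {ω | histOf (fun k => X k ω) 0 = [z]} =ᵐ[P] {_ω | (0 : ℤ) = z} := by
        filter_upwards [h0] with ω h
        exact propext h
      rw [measure_congr this]
      by_cases hz : z = 0
      · simp [hz, histProb]
      · simp [hz, Ne.symm hz, histProb]
    · simp [histOf]
  | succ n ih =>
    rcases l with _ | ⟨z', t⟩
    · simp [histOf]
    rcases t with _ | ⟨z, t⟩
    · simp [histOf, histOf_ne_nil]
    set A : Set Ω := {ω | histOf (fun k => X k ω) n = z :: t} with hA
    set e := z' - z with he
    have hAm : MeasurableSet[hX.filtration n] A := hX.measurableSet_histOf_eq n _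
    have hAm' : MeasurableSet A := hX.filtration.le n _ hAm
    have hAX : ∀ ω ∈ A, X n ω = z := fun ω hω => by
      have h := headD_histOf (fun k => X k ω) n
      rw [hω] at h
      exact h.symm
    have hset : {ω | histOf (fun k => X k ω) (n + 1) = z' :: z :: t} =
        A ∩ {ω | X (n + 1) ω = X n ω + e} := by
      ext ω
      simp only [Set.mem_ofPred_eq, histOf, List.cons.injEq, Set.mem_inter_iff]
      constructor
      · rintro ⟨h1, h2⟩
        exact ⟨h2, by rw [hAX ω h2]; omega⟩
      · rintro ⟨h1, h2⟩
        exact ⟨by rw [hAX ω h1] at h2; omega, h1⟩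
    rw [hset]
    have hgoal : P (A ∩ {ω | X (n + 1) ω = X n ω + e}) = P A * stepProb w (z :: t) e := by
      by_cases hee : e = 1 ∨ e = -1
      · rw [stepProb, if_pos hee]
        set c := rate w (z :: t) e / (rate w (z :: t) 1 + rate w (z :: t) (-1)) with hc
        have hc0 : 0 ≤ c := div_nonneg (rate_pos hw _ _).le
          (add_pos (rate_pos hw _ _) (rate_pos hw _ _)).le
        have hprob : ∀ ω ∈ A, jumpProb w X e n ω = c := by
          intro ω hω
          have hr : ∀ d, rate w (z :: t) d = w (localTime X n (X n ω + d) ω) := fun d => by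
            have := rate_histOf w (fun k => X k ω) n d
            rw [show histOf (fun k => X k ω) n = z :: t from hω] at this
            exact this
          rw [hc, hr, hr, hr]
          rfl
        have hEm := hX.measurableSet_jump e n
        have h0 := hX.integral_mul_innovation hw hee (n := n)
          (h := A.indicator fun _ => (1 : ℝ)) (measurable_const.indicator hAm) 1 (fun ω => by
            unfold Set.indicator; split_ifs <;> simp)
        have h1 : ∀ ω, A.indicator (fun _ => (1 : ℝ)) ω * innovation w X e n ω =
            (A ∩ {ω | X (n + 1) ω = X n ω + e}).indicator (fun _ => (1 : ℝ)) ω -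
              A.indicator (fun _ => c) ω := by
          intro ω
          unfold innovation
          generalize {ω | X (n + 1) ω = X n ω + e} = E
          by_cases hω : ω ∈ A
          · by_cases hω' : ω ∈ E <;> simp [Set.indicator, hω, hω', hprob ω hω]
          · simp [Set.indicator, hω]
        simp_rw [h1] at h0
        rw [integral_sub ((integrable_const 1).indicator (hAm'.inter hEm))
          ((integrable_const c).indicator hAm'), integral_indicator_const _ (hAm'.inter hEm),
          integral_indicator_const _ hAm', smul_eq_mul, smul_eq_mul, mul_one, sub_eq_zero] at h0
        rw [← ofReal_measureReal (measure_ne_top P (A ∩ _)), h0,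
          ENNReal.ofReal_mul measureReal_nonneg, ofReal_measureReal (measure_ne_top P A)]
      · rw [stepProb, if_neg hee, mul_zero]
        refine measure_mono_null (t := {ω | ¬ (X (n + 1) ω = X n ω + 1 ∨ X (n + 1) ω = X n ω - 1)})
          ?_ (ae_iff.1 (hX.nearest_neighbour n))
        rintro ω ⟨-, h⟩
        simp only [Set.mem_ofPred_eq] at h ⊢
        omega
    rw [hgoal, ih]
    simp only [List.length_cons, add_left_inj]
    split_ifs
    · rw [histProb]
    · simp

/-- The tie event depends on the path alone, so equality of path laws transfers its nullity without
building clocks on `Ω`. -/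
theorem IsVRRW.map_path_eq (hX : IsVRRW P w X) (hw : ∀ n, 0 < w n) :
    P.map (fun ω n => X n ω) = clockLaw.map (walk w) := by
  have := Measure.isProbabilityMeasure_map (μ := P) hX.measurable_path.aemeasurable
  have := Measure.isProbabilityMeasure_map (μ := clockLaw) (measurable_walk (w := w)).aemeasurable
  refine ext_of_histOf fun n l => ?_
  have hm : MeasurableSet {p : ℕ → ℤ | histOf p n = l} :=
    measurable_histOf n (measurableSet_singleton l)
  rw [Measure.map_apply hX.measurable_path hm, Measure.map_apply measurable_walk hm]
  refine (hX.measure_histOf hw n l).trans ((clockLaw_hist hw n l).symm.trans ?_)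
  congr 1
  ext ρ
  simp only [Set.mem_preimage, Set.mem_ofPred_eq, histOf_walk]

theorem IsVRRW.ae_notMem_tiePaths (hX : IsVRRW P w X) (hw : ∀ n, 0 < w n) (hmono : Monotone w)
    (x : ℤ) : ∀ᵐ ω ∂P, (fun n => X n ω) ∉ tiePaths w x := by
  have hm := measurableSet_tiePaths w x
  have h := clockLaw_walk_tiePaths hw hmono x
  rw [← Measure.map_apply measurable_walk hm, ← hX.map_path_eq hw,
    Measure.map_apply hX.measurable_path hm] at h
  exact measure_eq_zero_iff_ae_notMem.1 h

end PathLaw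

/-! ### The compensated process is a martingale bounded in `L²` -/

section Martingale

variable {Ω : Type*}

/-- Inverse weight of `x + e` when the walk is at `x` at time `n`, and `0` otherwise. -/
noncomputable def jumpSize (w : ℕ → ℝ) (X : ℕ → Ω → ℤ) (e x : ℤ) (n : ℕ) (ω : Ω) : ℝ :=
  if X n ω = x then 1 / w (localTime X n (x + e) ω) else 0

/-- The compensated process `Y^e(x)`. -/
noncomputable def compensatedY (w : ℕ → ℝ) (X : ℕ → Ω → ℤ) (e x : ℤ) (n : ℕ) (ω : Ω) : ℝ :=
  Y w X e n x ω - compensator w (fun k => X k ω) x n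

/-- Sum of the squared jumps of `Y^e(x)` before time `n`. -/
noncomputable def squaredJumps (w : ℕ → ℝ) (X : ℕ → Ω → ℤ) (e x : ℤ) (n : ℕ) (ω : Ω) : ℝ :=
  ∑ k ∈ Finset.range n, jumpSize w X e x k ω ^ 2 *
    {ω | X (k + 1) ω = X k ω + e}.indicator (fun _ => (1 : ℝ)) ω

variable {w : ℕ → ℝ} {X : ℕ → Ω → ℤ}

theorem jumpSize_nonneg (hw : ∀ n, 0 < w n) (e x : ℤ) (n : ℕ) (ω : Ω) :
    0 ≤ jumpSize w X e x n ω := by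
  unfold jumpSize
  split_ifs
  · exact (one_div_pos.2 (hw _)).le
  · exact le_rfl

theorem jumpSize_le (hw : ∀ n, 0 < w n) (hmono : Monotone w) (e x : ℤ) (n : ℕ) (ω : Ω) :
    jumpSize w X e x n ω ≤ 1 / w 0 := by
  unfold jumpSize
  split_ifs
  · exact one_div_le_one_div_of_le (hw 0) (hmono (Nat.zero_le _))
  · exact (one_div_pos.2 (hw _)).le

/-- At `x`, the jump size times the jump probability is the inverse total weight: the weight of `x +
e` cancels, so both directions share one compensator. -/
theorem compensatedY_succ (hw : ∀ n, 0 < w n) (e x : ℤ) (n : ℕ) (ω : Ω) :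
    compensatedY w X e x (n + 1) ω =
      compensatedY w X e x n ω + jumpSize w X e x n ω * innovation w X e n ω := by
  have key : (if X n ω = x ∧ X (n + 1) ω = x + e then 1 / w (localTime X n (x + e) ω) else 0) -
      (if X n ω = x then 1 / (w (localTime X n (x + 1) ω) + w (localTime X n (x - 1) ω)) else 0) =
      jumpSize w X e x n ω * innovation w X e n ω := by
    unfold jumpSize innovation jumpProb
    simp only [Set.indicator, Set.mem_ofPred_eq]
    by_cases h : X n ω = x
    · have h1 := hw (localTime X n (x + e) ω)
      have h2 := hw (localTime X n (x + 1) ω)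
      have h3 := hw (localTime X n (x - 1) ω)
      by_cases h' : X (n + 1) ω = x + e <;> simp only [h, h', true_and, if_true, if_false] <;>
        field_simp
      ring
    · simp [h]
  unfold compensatedY Y compensator
  rw [Finset.sum_range_succ, Finset.sum_range_succ, ← key]
  change _ + _ - (_ + if X n ω = x then
    1 / (w (localTime X n (x + 1) ω) + w (localTime X n (x - 1) ω)) else 0) = _
  ring

theorem abs_compensatedY_le (hw : ∀ n, 0 < w n) (hmono : Monotone w) {e : ℤ}
    (he : e = 1 ∨ e = -1) (x : ℤ) (n : ℕ) (ω : Ω) :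
    |compensatedY w X e x n ω| ≤ n * (1 / w 0) := by
  induction n with
  | zero => simp [compensatedY, Y, compensator]
  | succ n ih =>
    rw [compensatedY_succ hw]
    have h1 := jumpSize_nonneg (X := X) hw e x n ω
    have h2 := jumpSize_le (X := X) hw hmono e x n ω
    have h3 := abs_innovation_le hw X he n ω
    have h4 : |jumpSize w X e x n ω * innovation w X e n ω| ≤ 1 / w 0 := by
      rw [abs_mul, abs_of_nonneg h1]
      exact (mul_le_of_le_one_right h1 h3).trans h2
    push_cast
    linarith [abs_add_le (compensatedY w X e x n ω) (jumpSize w X e x n ω * innovation w X e n ω)]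

theorem squaredJumps_nonneg (e x : ℤ) (n : ℕ) (ω : Ω) :
    0 ≤ squaredJumps w X e x n ω :=
  Finset.sum_nonneg fun _ _ => mul_nonneg (sq_nonneg _)
    (Set.indicator_nonneg (fun _ _ => zero_le_one) _)

/-- Each counted jump increases the local time at `x + e`, so the values of `w` used have distinct
indices. The bound is pathwise. -/
theorem squaredJumps_le (hw : ∀ n, 0 < w n) (hsum : Summable fun n => 1 / w n ^ 2)
    (e x : ℤ) (n : ℕ) (ω : Ω) : squaredJumps w X e x n ω ≤ ∑' n, 1 / w n ^ 2 := by
  have hpos : ∀ k, 0 ≤ 1 / w k ^ 2 := fun k => by have := hw k; positivity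
  have key : squaredJumps w X e x n ω ≤
      ∑ j ∈ Finset.range (localTime X n (x + e) ω), 1 / w j ^ 2 := by
    induction n with
    | zero =>
      rw [squaredJumps, Finset.range_zero, Finset.sum_empty]
      exact Finset.sum_nonneg fun j _ => hpos j
    | succ n ih =>
      rw [squaredJumps, Finset.sum_range_succ, ← squaredJumps]
      have hZ : localTime X (n + 1) (x + e) ω =
          localTime X n (x + e) ω + if X (n + 1) ω = x + e then 1 else 0 := by
        rw [localTime, Finset.sum_range_succ, localTime]
      rw [hZ]
      unfold jumpSize
      simp only [Set.indicator, Set.mem_ofPred_eq]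
      by_cases h : X n ω = x
      · by_cases h' : X (n + 1) ω = x + e
        · simp only [h, h', if_true, Finset.sum_range_succ, one_div, inv_pow, mul_one]
          simp only [one_div] at ih
          linarith
        · simpa [h, h'] using ih
      · simp only [h, if_false]
        rw [zero_pow two_ne_zero, zero_mul, add_zero]
        refine ih.trans ?_
        exact Finset.sum_le_sum_of_subset_of_nonneg (Finset.range_mono (Nat.le_add_right _ _))
          fun j _ _ => hpos j
  exact key.trans (hsum.sum_le_tsum _ fun j _ => hpos j)

variable [MeasurableSpace Ω] {P : Measure Ω}

theorem IsVRRW.measurable_jumpSize (hX : IsVRRW P w X) (e x : ℤ) (n : ℕ) :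
    Measurable[hX.filtration n] (jumpSize w X e x n) := by
  refine Measurable.ite (hX.measurable_of_le le_rfl (measurableSet_singleton x)) ?_
    measurable_const
  exact measurable_const.div
    ((measurable_of_countable w).comp (hX.measurable_localTime le_rfl (x + e)))

theorem IsVRRW.measurable_compensatedY (hX : IsVRRW P w X) (hw : ∀ n, 0 < w n) (e x : ℤ) (n : ℕ) :
    Measurable[hX.filtration n] (compensatedY w X e x n) := by
  induction n with
  | zero =>
    have : compensatedY w X e x 0 = fun _ => 0 := by
      funext ω; simp [compensatedY, Y, compensator]
    rw [this]
    exact measurable_const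
  | succ n ih =>
    have hle := hX.filtration.mono (Nat.le_succ n)
    have : compensatedY w X e x (n + 1) = fun ω =>
        compensatedY w X e x n ω + jumpSize w X e x n ω * innovation w X e n ω := by
      funext ω; exact compensatedY_succ hw e x n ω
    rw [this]
    refine (ih.mono hle le_rfl).add (((hX.measurable_jumpSize e x n).mono hle le_rfl).mul ?_)
    refine Measurable.sub (measurable_const.indicator ?_) ((hX.measurable_jumpProb e n).mono hle
      le_rfl)
    exact measurableSet_eq_fun (hX.measurable_of_le le_rfl)
      ((hX.measurable_of_le (Nat.le_succ n)).add_const e)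

theorem IsVRRW.measurable_squaredJumps (hX : IsVRRW P w X) (e x : ℤ) (n : ℕ) :
    Measurable (squaredJumps w X e x n) := by
  change Measurable fun ω => squaredJumps w X e x n ω
  unfold squaredJumps
  refine Finset.measurable_sum _ fun k _ => ?_
  exact (((hX.measurable_jumpSize e x k).mono (hX.filtration.le k) le_rfl).pow_const 2).mul
    (measurable_const.indicator (hX.measurableSet_jump e k))

variable [IsProbabilityMeasure P]

theorem IsVRRW.integrable_compensatedY (hX : IsVRRW P w X) (hw : ∀ n, 0 < w n)
    (hmono : Monotone w) {e : ℤ} (he : e = 1 ∨ e = -1) (x : ℤ) (n : ℕ) :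
    Integrable (compensatedY w X e x n) P :=
  integrable_of_abs_le ((hX.measurable_compensatedY hw e x n).mono (hX.filtration.le n) le_rfl) _
    (abs_compensatedY_le hw hmono he x n)

theorem IsVRRW.integrable_compensatedY_sq (hX : IsVRRW P w X) (hw : ∀ n, 0 < w n)
    (hmono : Monotone w) {e : ℤ} (he : e = 1 ∨ e = -1) (x : ℤ) (n : ℕ) :
    Integrable (fun ω => compensatedY w X e x n ω ^ 2) P :=
  integrable_of_abs_le (((hX.measurable_compensatedY hw e x n).mono (hX.filtration.le n)
    le_rfl).pow_const 2) ((n * (1 / w 0)) ^ 2) fun ω => by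
      rw [abs_pow]
      exact pow_le_pow_left₀ (abs_nonneg _) (abs_compensatedY_le hw hmono he x n ω) 2

theorem IsVRRW.integrable_squaredJumps (hX : IsVRRW P w X) (hw : ∀ n, 0 < w n)
    (hsum : Summable fun n => 1 / w n ^ 2) (e x : ℤ) (n : ℕ) :
    Integrable (squaredJumps w X e x n) P :=
  integrable_of_abs_le (hX.measurable_squaredJumps e x n) _ fun ω => by
    rw [abs_of_nonneg (squaredJumps_nonneg e x n ω)]
    exact squaredJumps_le hw hsum e x n ω

theorem IsVRRW.martingale_compensatedY (hX : IsVRRW P w X) (hw : ∀ n, 0 < w n)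
    (hmono : Monotone w) {e : ℤ} (he : e = 1 ∨ e = -1) (x : ℤ) :
    Martingale (compensatedY w X e x) hX.filtration P := by
  refine martingale_of_condExp_sub_eq_zero_nat
    (fun n => (hX.measurable_compensatedY hw e x n).stronglyMeasurable)
    (hX.integrable_compensatedY hw hmono he x) fun n => ?_
  have : compensatedY w X e x (n + 1) - compensatedY w X e x n =
      jumpSize w X e x n * innovation w X e n := by
    funext ω
    rw [Pi.sub_apply, compensatedY_succ hw, add_sub_cancel_left, Pi.mul_apply]
  rw [this]
  refine hX.condExp_mul_innovation hw he (hX.measurable_jumpSize e x n) (1 / w 0) fun ω => ?_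
  rw [abs_of_nonneg (jumpSize_nonneg hw e x n ω)]
  exact jumpSize_le hw hmono e x n ω

theorem IsVRRW.integral_compensatedY_sq_le (hX : IsVRRW P w X) (hw : ∀ n, 0 < w n)
    (hmono : Monotone w) (hsum : Summable fun n => 1 / w n ^ 2) {e : ℤ} (he : e = 1 ∨ e = -1)
    (x : ℤ) (n : ℕ) : ∫ ω, compensatedY w X e x n ω ^ 2 ∂P ≤ ∑' n, 1 / w n ^ 2 := by
  have key : ∫ ω, (compensatedY w X e x n ω ^ 2 - squaredJumps w X e x n ω) ∂P ≤ 0 := by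
    induction n with
    | zero => simp [compensatedY, Y, compensator, squaredJumps]
    | succ n ih =>
      -- `h` is the predictable coefficient of the innovation in the increment of `D² - Q`, where
      -- `D` is the compensated process and `Q` the sum of squared jumps. The rest of the increment
      -- is `-(g q)² ≤ 0`, with `g` the jump size and `q` the jump probability.
      set h : Ω → ℝ := fun ω => 2 * compensatedY w X e x n ω * jumpSize w X e x n ω -
        2 * jumpSize w X e x n ω ^ 2 * jumpProb w X e n ω with hh
      have hm : Measurable[hX.filtration n] h :=
        (((hX.measurable_compensatedY hw e x n).const_mul 2).mul
          (hX.measurable_jumpSize e x n)).sub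
          ((((hX.measurable_jumpSize e x n).pow_const 2).const_mul 2).mul
            (hX.measurable_jumpProb e n))
      set C := 2 * (n * (1 / w 0)) * (1 / w 0) + 2 * (1 / w 0) ^ 2 with hC
      have hw0 := one_div_pos.2 (hw 0)
      have hb : ∀ ω, |h ω| ≤ C := by
        intro ω
        have h1 := jumpSize_nonneg (X := X) hw e x n ω
        have h2 := jumpSize_le (X := X) hw hmono e x n ω
        have h3 := abs_compensatedY_le (X := X) hw hmono he x n ω
        have h4 := jumpProb_nonneg hw X e n ω
        have h5 := jumpProb_le_one hw X he n ω
        refine (abs_sub _ _).trans (add_le_add ?_ ?_)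
        · rw [abs_mul, abs_mul, abs_of_nonneg h1, abs_two]
          gcongr
        · rw [abs_of_nonneg (by positivity)]
          calc 2 * jumpSize w X e x n ω ^ 2 * jumpProb w X e n ω
              ≤ 2 * jumpSize w X e x n ω ^ 2 := mul_le_of_le_one_right (by positivity) h5
            _ ≤ 2 * (1 / w 0) ^ 2 := by gcongr
      have h0 := hX.integral_mul_innovation hw he hm C hb
      have hInt : Integrable (fun ω => h ω * innovation w X e n ω) P :=
        integrable_of_abs_le ((hm.mono (hX.filtration.le n) le_rfl).mul
          (hX.measurable_innovation e n)) C fun ω => by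
            rw [abs_mul]
            exact (mul_le_of_le_one_right (abs_nonneg _) (abs_innovation_le hw X he n ω)).trans (hb ω)
      have hInt' : Integrable (fun ω => compensatedY w X e x n ω ^ 2 - squaredJumps w X e x n ω) P :=
        (hX.integrable_compensatedY_sq hw hmono he x n).sub
          (hX.integrable_squaredJumps hw hsum e x n)
      calc ∫ ω, (compensatedY w X e x (n + 1) ω ^ 2 - squaredJumps w X e x (n + 1) ω) ∂P
          ≤ ∫ ω, ((compensatedY w X e x n ω ^ 2 - squaredJumps w X e x n ω) +
              h ω * innovation w X e n ω) ∂P := by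
            refine integral_mono ((hX.integrable_compensatedY_sq hw hmono he x (n + 1)).sub
              (hX.integrable_squaredJumps hw hsum e x (n + 1))) (hInt'.add hInt) fun ω => ?_
            simp only [hh]
            rw [compensatedY_succ hw]
            have hs : squaredJumps w X e x (n + 1) ω = squaredJumps w X e x n ω +
                jumpSize w X e x n ω ^ 2 *
                  {ω | X (n + 1) ω = X n ω + e}.indicator (fun _ => (1 : ℝ)) ω := by
              rw [squaredJumps, Finset.sum_range_succ, ← squaredJumps]
            rw [hs]
            unfold innovation
            have hi : {ω | X (n + 1) ω = X n ω + e}.indicator (fun _ => (1 : ℝ)) ω ^ 2 =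
                {ω | X (n + 1) ω = X n ω + e}.indicator (fun _ => (1 : ℝ)) ω := by
              unfold Set.indicator; split_ifs <;> simp
            generalize {ω | X (n + 1) ω = X n ω + e}.indicator (fun _ => (1 : ℝ)) ω = i at hi ⊢
            generalize jumpProb w X e n ω = q
            generalize jumpSize w X e x n ω = g
            generalize compensatedY w X e x n ω = D
            generalize squaredJumps w X e x n ω = Q
            have : (D + g * (i - q)) ^ 2 - (Q + g ^ 2 * i) =
                D ^ 2 - Q + (2 * D * g - 2 * g ^ 2 * q) * (i - q) - g ^ 2 * q ^ 2 := by
              have e2 : g ^ 2 * i = g ^ 2 * i ^ 2 := by rw [hi]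
              rw [e2]; ring
            rw [this]
            nlinarith [sq_nonneg (g * q)]
        _ = ∫ ω, (compensatedY w X e x n ω ^ 2 - squaredJumps w X e x n ω) ∂P := by
            rw [integral_add hInt' hInt, h0, add_zero]
        _ ≤ 0 := ih
  rw [integral_sub (hX.integrable_compensatedY_sq hw hmono he x n)
    (hX.integrable_squaredJumps hw hsum e x n)] at key
  have h2 : ∫ ω, squaredJumps w X e x n ω ∂P ≤ ∫ _, (∑' n, 1 / w n ^ 2) ∂P :=
    integral_mono (hX.integrable_squaredJumps hw hsum e x n) (integrable_const _)
      fun ω => squaredJumps_le hw hsum e x n ω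
  rw [integral_const, probReal_univ, one_smul] at h2
  linarith

theorem IsVRRW.ae_tendsto_compensatedY (hX : IsVRRW P w X) (hw : ∀ n, 0 < w n)
    (hmono : Monotone w) (hsum : Summable fun n => 1 / w n ^ 2) {e : ℤ} (he : e = 1 ∨ e = -1)
    (x : ℤ) : ∀ᵐ ω ∂P, ∃ c, Tendsto (fun n => compensatedY w X e x n ω) atTop (𝓝 c) := by
  set C := ∑' n, 1 / w n ^ 2 with hC
  refine (hX.martingale_compensatedY hw hmono he x).submartingale.exists_ae_tendsto_of_bdd
    (R := (1 + C).toNNReal) fun n => ?_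
  rw [eLpNorm_one_eq_lintegral_enorm]
  have hInt := hX.integrable_compensatedY hw hmono he x n
  rw [← ofReal_integral_norm_eq_lintegral_enorm hInt]
  refine ENNReal.ofReal_le_ofReal ?_
  calc ∫ ω, ‖compensatedY w X e x n ω‖ ∂P ≤ ∫ ω, (1 + compensatedY w X e x n ω ^ 2) ∂P := by
        refine integral_mono hInt.norm ((integrable_const 1).add
          (hX.integrable_compensatedY_sq hw hmono he x n)) fun ω => ?_
        simp only [Real.norm_eq_abs]
        nlinarith [sq_abs (compensatedY w X e x n ω), sq_nonneg (|compensatedY w X e x n ω| - 1)]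
    _ = 1 + ∫ ω, compensatedY w X e x n ω ^ 2 ∂P := by
        rw [integral_add (integrable_const 1) (hX.integrable_compensatedY_sq hw hmono he x n)]
        simp
    _ ≤ 1 + C := by
        have := hX.integral_compensatedY_sq_le hw hmono hsum he x n
        linarith

theorem IsVRRW.ae_YInf_lt_top_iff (hX : IsVRRW P w X) (hw : ∀ n, 0 < w n)
    (hmono : Monotone w) (hsum : Summable fun n => 1 / w n ^ 2) {e : ℤ} (he : e = 1 ∨ e = -1)
    (x : ℤ) : ∀ᵐ ω ∂P, YInf w X e x ω < ∞ ↔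
      BddAbove (Set.range (compensator w (fun k => X k ω) x)) := by
  filter_upwards [hX.ae_tendsto_compensatedY hw hmono hsum he x] with ω ⟨c, hc⟩
  obtain ⟨a, ha⟩ := hc.bddAbove_range
  obtain ⟨b, hb⟩ := hc.bddBelow_range
  have hY0 : ∀ n, 0 ≤ Y w X e n x ω := fun n => Finset.sum_nonneg fun k _ => by
    split_ifs
    · exact (one_div_pos.2 (hw _)).le
    · exact le_rfl
  constructor
  · intro h
    refine ⟨(YInf w X e x ω).toReal - b, ?_⟩
    rintro _ ⟨n, rfl⟩
    have h1 : Y w X e n x ω ≤ (YInf w X e x ω).toReal := by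
      rw [← ENNReal.ofReal_le_iff_le_toReal h.ne]
      exact le_iSup (fun n => ENNReal.ofReal (Y w X e n x ω)) n
    have h2 : b ≤ compensatedY w X e x n ω := hb ⟨n, rfl⟩
    unfold compensatedY at h2
    linarith
  · rintro ⟨K, hK⟩
    refine lt_of_le_of_lt (b := ENNReal.ofReal (K + a)) (iSup_le fun n => ?_)
      ENNReal.ofReal_lt_top
    refine ENNReal.ofReal_le_ofReal ?_
    have h1 : compensator w (fun k => X k ω) x n ≤ K := hK ⟨n, rfl⟩
    have h2 : compensatedY w X e x n ω ≤ a := ha ⟨n, rfl⟩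
    unfold compensatedY at h2
    linarith

end Martingale

/-! ### Local times and the conclusion -/

section Conclusion

variable {Ω : Type*} {w : ℕ → ℝ} {X : ℕ → Ω → ℤ}

/-- Every nonzero term of `Y` comes with a new visit to `x + e` and is at most `1 / w 0`. -/
theorem Y_le_localTime (hw : ∀ n, 0 < w n) (hmono : Monotone w) (e x : ℤ) (n : ℕ) (ω : Ω) :
    Y w X e n x ω ≤ 1 / w 0 * localTime X n (x + e) ω := by
  have h0 := one_div_pos.2 (hw 0)
  induction n with
  | zero =>
    rw [Y, Finset.range_zero, Finset.sum_empty]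
    positivity
  | succ n ih =>
    have hZ : localTime X (n + 1) (x + e) ω =
        localTime X n (x + e) ω + if X (n + 1) ω = x + e then 1 else 0 := by
      rw [localTime, Finset.sum_range_succ, localTime]
    rw [Y, Finset.sum_range_succ, ← Y, hZ, Nat.cast_add, mul_add]
    refine add_le_add ih ?_
    by_cases h' : X (n + 1) ω = x + e
    · simp only [h', if_true, and_true, Nat.cast_one, mul_one]
      split_ifs
      · exact one_div_le_one_div_of_le (hw 0) (hmono (Nat.zero_le _))
      · exact h0.le
    · simp [h']

theorem YInf_lt_top_of_localTimeInf_lt_top (hw : ∀ n, 0 < w n) (hmono : Monotone w) {e x : ℤ}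
    {ω : Ω} (h : localTimeInf X (x + e) ω < ⊤) : YInf w X e x ω < ∞ := by
  obtain ⟨M, hM⟩ := ENat.ne_top_iff_exists.1 h.ne
  refine lt_of_le_of_lt (b := ENNReal.ofReal (1 / w 0 * M)) (iSup_le fun n => ?_)
    ENNReal.ofReal_lt_top
  refine ENNReal.ofReal_le_ofReal ((Y_le_localTime hw hmono e x n ω).trans ?_)
  have h1 : (localTime X n (x + e) ω : ℕ∞) ≤ M := by
    rw [hM]
    exact le_iSup (fun n => (localTime X n (x + e) ω : ℕ∞)) n
  have h2 : localTime X n (x + e) ω ≤ M := by exact_mod_cast h1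
  have h0 := one_div_pos.2 (hw 0)
  gcongr

theorem exists_ge_of_localTimeInf_eq_top {y : ℤ} {ω : Ω} (h : localTimeInf X y ω = ⊤) (N : ℕ) :
    ∃ n ≥ N, X n ω = y := by
  by_contra! hno
  have hle : ∀ n, localTime X n y ω ≤ N := by
    intro n
    calc localTime X n y ω ≤ ∑ k ∈ Finset.range (n + 1), if k < N then 1 else 0 := by
          refine Finset.sum_le_sum fun k _ => ?_
          by_cases hk : k < N
          · simp only [hk, if_true]; split_ifs <;> simp
          · rw [if_neg (hno k (by omega))]; exact Nat.zero_le _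
      _ = ((Finset.range (n + 1)).filter (· < N)).card := by rw [Finset.card_filter]
      _ ≤ (Finset.range N).card := Finset.card_le_card fun k hk => by
          simp only [Finset.mem_filter] at hk
          exact Finset.mem_range.2 hk.2
      _ = N := Finset.card_range N
  have : localTimeInf X y ω ≤ N := iSup_le fun n => by exact_mod_cast hle n
  rw [h] at this
  exact absurd this (by simp)

end Conclusion

end VRRW

theorem mainTheorem7 {Ω : Type*} [MeasurableSpace Ω] (P : Measure Ω) [IsProbabilityMeasure P]
    (w : ℕ → ℝ) (hpos : ∀ n, 0 < w n) (hmono : Monotone w)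
    (hsum : Summable fun n => 1 / w n ^ 2)
    (X : ℕ → Ω → ℤ) (hX : VRRW.IsVRRW P w X) (x : ℤ) :
    ({ω | VRRW.YInf w X 1 x ω < ∞} =ᵐ[P] {ω | VRRW.YInf w X (-1) x ω < ∞}) ∧
    ({ω | VRRW.YInf w X (-1) x ω < ∞} =ᵐ[P]
      ({ω | VRRW.localTimeInf X (x - 1) ω < ⊤} ∪ {ω | VRRW.localTimeInf X (x + 1) ω < ⊤} :
        Set Ω)) := by
  have hR := hX.ae_YInf_lt_top_iff hpos hmono hsum (e := 1) (Or.inl rfl) x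
  have hL := hX.ae_YInf_lt_top_iff hpos hmono hsum (e := -1) (Or.inr rfl) x
  constructor
  · filter_upwards [hR, hL] with ω h1 h2
    exact propext (h1.trans h2.symm)
  · filter_upwards [hR, hL, hX.ae_notMem_tiePaths hpos hmono x] with ω h1 h2 h3
    refine propext ⟨fun h => ?_, fun h => ?_⟩
    · change _ ∨ _
      by_contra hno
      obtain ⟨ha, hb⟩ := not_or.1 hno
      -- Finiteness of `Y^-_∞` bounds the compensator, so infinite local times at both neighbours
      -- would give a tie path.
      refine h3 ⟨VRRW.exists_ge_of_localTimeInf_eq_top (not_lt_top_iff.1 hb),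
        VRRW.exists_ge_of_localTimeInf_eq_top (not_lt_top_iff.1 ha), h2.1 h⟩
    · rcases h with h | h
      · exact VRRW.YInf_lt_top_of_localTimeInf_lt_top hpos hmono h
      -- Finite local time at `x + 1` controls `Y^+`; the shared compensator passes finiteness on to
      -- `Y^-`.
      · exact h2.2 (h1.1 (VRRW.YInf_lt_top_of_localTimeInf_lt_top hpos hmono h))
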